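/- **Definitions.** Let $f:[0,\infty)\to[0,\infty)$ be super-additive, i.e. $f(y+z)\ge f(y)+f(z)$. We call $f$ approximately invertible with parameters $\theta,\theta',\theta''>1$ and $\varepsilon_1,\varepsilon_2\in(0,1)$ if for all $y\ge 0$: $f(\theta' y)\ge\theta f(y)$; $f\big(y/(4\sqrt{\theta}\,\theta')\big)\ge f(y)/\theta''$; and, for all $0\le z\le y$, $f(z)\le\varepsilon_1 f(y)$ implies $f(y-z)\ge(1-\varepsilon_2)f(y)$. (The last condition always holds for $\varepsilon_1=1/\theta''$, $\varepsilon_2=1-1/\theta''$.) For an integer $t\ge1$ let $c_f[t]\ge 0$ be the smallest number with $$f(y_1+\dots+y_t)\le \frac{c_f[t]}{t}\big(\sqrt{f(y_1)}+\dots+\sqrt{f(y_t)}\big)^2\qquad\text{for all }y_1,\dots,y_t\ge 0 .$$ In the coordinator model, server $j\in[s]$ holds a vector $x(j)\in\mathbb{R}_{\ge0}^n$; put $x=\sum_j x(j)$. The servers and the coordinator share independent standard exponential random variables $\mathbf e_1,\dots,\mathbf e_n$; each server also has private coins, independent of everything else. In a 2-round protocol each server sends a message to the coordinator, the coordinator answers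 each server, each server sends a second message, and the coordinator outputs a number. A message is a list of words. A word is either a coordinate $i\in[n]$ or a real number that the sender holds: a server may write an entry $x_i(j)$ of its vector, its local sum $\sum_i\mathbf e_i^{-1}f(x_i(j))$, or a number it has received; the coordinator may only forward numbers it has received. The total communication is the number of words in all messages, in both directions. **Theorem.** For every $c\in\mathbb{N}$ there is a constant $K>0$ such that the following holds for all $n,s\ge1$ and every super-additive $f:[0,\infty)\to[0,\infty)$ that is approximately invertible with parameters $\theta,\theta',\theta'',\varepsilon_1,\varepsilon_2$. Let $$A=\Big\lceil K\,\frac{\log (s/\varepsilon_1)}{\log\theta}\Big\rceil,\qquad B=\Big\lceil K\,\frac{\log \big(s^2/(\varepsilon_1(1-\varepsilon_2))\big)}{\log\theta}\Big\rceil .$$ There is a 2-round protocol in the coordinator model which, on every input $x(1),\dots,x(s)\in\mathbb{R}_{\ge 0}^n$, always uses at most $$K\left(c_f[s]\cdot\frac{c_f[AB]\cdot AB\cdot\sqrt{\theta}\,\log^4 n}{\varepsilon_1(1-\varepsilon_2)^2}+s\cdot\frac{\log^2 n\cdot\theta''}{(1-\varepsilon_2)^3}\right)$$ words of communication, and with probability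 at least $1-1/n^{c}$ its output is exactly $\max_{i\in[n]}\mathbf e_i^{-1}f(x_i)$. -/

import Mathlib

open MeasureTheory ProbabilityTheory

noncomputable section

/-- `f`, on the non-negative reals, is non-negative, super-additive and approximately invertible with
parameters `θ, θ', θ'' > 1` and `ε₁, ε₂ ∈ (0, 1)`. The last two parameters are constrained only by
`sub_stable`; the pair `ε₁ = 1 / θ''`, `ε₂ = 1 - 1 / θ''` always qualifies, see
`ApproxInvertible.of_theta`. -/
structure ApproxInvertible (f : ℝ → ℝ) (θ θ' θ'' ε₁ ε₂ : ℝ) : Prop where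
  one_lt_theta : 1 < θ
  one_lt_theta' : 1 < θ'
  one_lt_theta'' : 1 < θ''
  eps₁_pos : 0 < ε₁
  eps₁_lt_one : ε₁ < 1
  eps₂_pos : 0 < ε₂
  eps₂_lt_one : ε₂ < 1
  nonneg : ∀ y, 0 ≤ y → 0 ≤ f y
  superadd : ∀ y z, 0 ≤ y → 0 ≤ z → f y + f z ≤ f (y + z)
  scale_up : ∀ y, 0 ≤ y → θ * f y ≤ f (θ' * y)
  scale_down : ∀ y, 0 ≤ y → f y / θ'' ≤ f (y / (4 * √θ * θ'))
  sub_stable : ∀ y z, 0 ≤ z → z ≤ y → f z ≤ ε₁ * f y → (1 - ε₂) * f y ≤ f (y - z)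

/-- A non-negative super-additive function is monotone. -/
theorem mono_of_superadd {f : ℝ → ℝ} (h0 : ∀ y, 0 ≤ y → 0 ≤ f y)
    (hs : ∀ y z, 0 ≤ y → 0 ≤ z → f y + f z ≤ f (y + z)) {a b : ℝ} (ha : 0 ≤ a) (hab : a ≤ b) :
    f a ≤ f b := by
  have h1 := hs a (b - a) ha (by linarith)
  have h2 := h0 (b - a) (by linarith)
  have h3 : a + (b - a) = b := by ring
  rw [h3] at h1
  linarith

/-- The choice `ε₁ = 1 / θ''`, `ε₂ = 1 - 1 / θ''` is always admissible. -/
theorem ApproxInvertible.of_theta {f : ℝ → ℝ} {θ θ' θ'' : ℝ} (h1 : 1 < θ) (h2 : 1 < θ')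
    (h3 : 1 < θ'') (h0 : ∀ y, 0 ≤ y → 0 ≤ f y)
    (hs : ∀ y z, 0 ≤ y → 0 ≤ z → f y + f z ≤ f (y + z))
    (hu : ∀ y, 0 ≤ y → θ * f y ≤ f (θ' * y))
    (hd : ∀ y, 0 ≤ y → f y / θ'' ≤ f (y / (4 * √θ * θ'))) :
    ApproxInvertible f θ θ' θ'' (1 / θ'') (1 - 1 / θ'') := by
  have hpos : 0 < θ'' := by linarith
  have hlt : 1 / θ'' < 1 := by rw [div_lt_one hpos]; exact h3
  have hip : 0 < 1 / θ'' := by positivity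
  refine ⟨h1, h2, h3, hip, hlt, by linarith, by linarith, h0, hs, hu, hd, ?_⟩
  intro y z hz hzy hf
  have hy : 0 ≤ y := hz.trans hzy
  have hsq : 1 ≤ √θ := by rw [Real.one_le_sqrt]; exact h1.le
  have hρ : 4 ≤ 4 * √θ * θ' := by nlinarith
  have hd' := hd y hy
  have hq : y / (4 * √θ * θ') ≤ y / 4 := div_le_div_of_nonneg_left hy (by norm_num) hρ
  have hq0 : 0 ≤ y / (4 * √θ * θ') := by positivity
  have hm := mono_of_superadd h0 hs hq0 hq
  have e1 : (1 - (1 - 1 / θ'')) * f y = f y / θ'' := by ring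
  have e2 : 1 / θ'' * f y = f y / θ'' := by ring
  rw [e1]
  rw [e2] at hf
  by_cases hc : z ≤ y / 2
  · have := mono_of_superadd h0 hs (show 0 ≤ y / 4 by linarith) (show y / 4 ≤ y - z by linarith)
    linarith
  · have hc' : y / 2 ≤ z := by linarith
    have h5 := mono_of_superadd h0 hs (show 0 ≤ y / 2 by linarith) hc'
    have h6 := hs (y / 4) (y / 4) (by linarith) (by linarith)
    have h7 : y / 4 + y / 4 = y / 2 := by ring
    rw [h7] at h6
    have h8 := h0 (y - z) (by linarith)
    have h9 := h0 (y / 4) (by linarith)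
    linarith

/-- The constants admissible in the definition of `c_f[t]`. -/
def cfSet (f : ℝ → ℝ) (t : ℕ) : Set ℝ :=
  {c | 0 ≤ c ∧ ∀ y : Fin t → ℝ, (∀ i, 0 ≤ y i) →
    f (∑ i, y i) ≤ c / t * (∑ i, √(f (y i))) ^ 2}

/-- `c_f[t]`: the smallest `c ≥ 0` with
`f (y₁ + ⋯ + y_t) ≤ (c / t) (√(f y₁) + ⋯ + √(f y_t))²` for all `y₁, …, y_t ≥ 0`.
The smallest such `c` exists, see `ApproxInvertible.isLeast_cf`. -/
def cf (f : ℝ → ℝ) (t : ℕ) : ℝ := sInf (cfSet f t)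

theorem ApproxInvertible.isLeast_cf {f : ℝ → ℝ} {θ θ' θ'' ε₁ ε₂ : ℝ}
    (h : ApproxInvertible f θ θ' θ'' ε₁ ε₂) {t : ℕ} (ht : 1 ≤ t) :
    IsLeast (cfSet f t) (cf f t) := by
  have hbdd : BddBelow (cfSet f t) := ⟨0, fun c hc => hc.1⟩
  have htp : (0 : ℝ) < t := by exact_mod_cast ht
  have hclosed : IsClosed (cfSet f t) := by
    have : cfSet f t = Set.Ici 0 ∩ ⋂ y : {y : Fin t → ℝ // ∀ i, 0 ≤ y i},
        {c : ℝ | f (∑ i, y.1 i) ≤ c / t * (∑ i, √(f (y.1 i))) ^ 2} := by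
      ext c
      simp [cfSet]
    rw [this]
    refine isClosed_Ici.inter (isClosed_iInter fun y => ?_)
    exact isClosed_le continuous_const (by fun_prop)
  have hne : (cfSet f t).Nonempty := by
    have h1 := h.one_lt_theta
    have h2 := h.one_lt_theta'
    have h3 := h.one_lt_theta''
    have hsq : 1 ≤ √θ := by rw [Real.one_le_sqrt]; exact h1.le
    have hρ : 1 < 4 * √θ * θ' := by nlinarith
    have hpow : ∀ (k : ℕ) (y : ℝ), 0 ≤ y → f ((4 * √θ * θ') ^ k * y) ≤ θ'' ^ k * f y := by
      intro k
      induction k with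
      | zero => intro y hy; simp
      | succ k ih =>
        intro y hy
        have hp : 0 ≤ (4 * √θ * θ') ^ k * y := by positivity
        have hd := h.scale_down ((4 * √θ * θ') * ((4 * √θ * θ') ^ k * y)) (by positivity)
        rw [mul_div_cancel_left₀ _ (by positivity), div_le_iff₀ (by linarith)] at hd
        have e : (4 * √θ * θ') ^ (k + 1) * y = (4 * √θ * θ') * ((4 * √θ * θ') ^ k * y) := by ring
        rw [e]
        calc _ ≤ _ := hd
          _ ≤ θ'' ^ k * f y * θ'' := by gcongr; exact ih y hy
          _ = _ := by ring
    obtain ⟨k, hk⟩ := pow_unbounded_of_one_lt (t : ℝ) hρ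
    refine ⟨t * θ'' ^ k, by positivity, fun y hy => ?_⟩
    have : Nonempty (Fin t) := ⟨⟨0, ht⟩⟩
    obtain ⟨m, hm⟩ := Finite.exists_max y
    have hsum : ∑ i, y i ≤ (4 * √θ * θ') ^ k * y m := by
      calc ∑ i, y i ≤ ∑ _i : Fin t, y m := Finset.sum_le_sum fun i _ => hm i
        _ = t * y m := by simp
        _ ≤ _ := by gcongr; exact hy m
    have hf := mono_of_superadd h.nonneg h.superadd (Finset.sum_nonneg fun i _ => hy i) hsum
    have hs : √(f (y m)) ≤ ∑ i, √(f (y i)) :=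
      Finset.single_le_sum (f := fun i => √(f (y i))) (fun i _ => Real.sqrt_nonneg _)
        (Finset.mem_univ m)
    have hs2 : f (y m) ≤ (∑ i, √(f (y i))) ^ 2 := by
      rw [← Real.sq_sqrt (h.nonneg _ (hy m))]
      gcongr
    rw [mul_div_cancel_left₀ _ htp.ne']
    calc _ ≤ _ := hf
      _ ≤ θ'' ^ k * f (y m) := hpow k _ (hy m)
      _ ≤ _ := by gcongr
  exact ⟨hclosed.csInf_mem hne hbdd, fun c hc => csInf_le hbdd hc⟩

/-- One word of communication: a coordinate in `[n]` or a real number. Which real numbers may be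
written into a word is restricted by `TwoRoundProtocol.NumbersAreHeld`. -/
inductive Word (n : ℕ) : Type
  | index (i : Fin n) : Word n
  | number (r : ℝ) : Word n

/-- The real numbers occurring in a message. -/
def numbersIn {n : ℕ} (m : List (Word n)) : Set ℝ := {r | Word.number r ∈ m}

/-- The real numbers that a server with vector `v` holds: its entries and the normalisation
`∑ᵢ eᵢ⁻¹ f(vᵢ)` of its weights. -/
def localNumbers {n : ℕ} (f : ℝ → ℝ) (e v : Fin n → ℝ) : Set ℝ :=
  {r | (∃ i, r = v i) ∨ r = ∑ i, (e i)⁻¹ * f (v i)}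

/-- A two-round protocol in the coordinator model with `s` servers that hold vectors in `ℝⁿ`.
All parties see the vector `e` of shared random variables; server `j` has in addition its own coin
`ω j`. In the first round server `j` sends `report j` to the coordinator, which then sends `query`
to each of the servers. In the second round server `j` sends `answer j`, and the coordinator computes
`output`. No bound is put on local computation. -/
structure TwoRoundProtocol (s n : ℕ) where
  Coin : Type
  [coinSpace : MeasurableSpace Coin]
  coinLaw : Measure Coin
  [coinProb : IsProbabilityMeasure coinLaw]
  /-- server, its vector, shared randomness, its coin -/
  report : Fin s → (Fin n → ℝ) → (Fin n → ℝ) → Coin → List (Word n)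
  /-- shared randomness, all the reports, addressed server -/
  query : (Fin n → ℝ) → (Fin s → List (Word n)) → Fin s → List (Word n)
  /-- server, its vector, shared randomness, its coin, the received query -/
  answer : Fin s → (Fin n → ℝ) → (Fin n → ℝ) → Coin → List (Word n) → List (Word n)
  /-- shared randomness, all the reports, all the answers -/
  output : (Fin n → ℝ) → (Fin s → List (Word n)) → (Fin s → List (Word n)) → ℝ

namespace TwoRoundProtocol

attribute [instance] coinSpace coinProb

variable {s n : ℕ} (P : TwoRoundProtocol s n)

/-- The first-round messages on input `x`, where server `j` holds `x j`. -/
def reports (x : Fin s → Fin n → ℝ) (e : Fin n → ℝ) (ω : Fin s → P.Coin) (j : Fin s) :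
    List (Word n) :=
  P.report j (x j) e (ω j)

/-- The messages from the coordinator to the servers. -/
def queries (x : Fin s → Fin n → ℝ) (e : Fin n → ℝ) (ω : Fin s → P.Coin) (j : Fin s) :
    List (Word n) :=
  P.query e (P.reports x e ω) j

/-- The second-round messages. -/
def answers (x : Fin s → Fin n → ℝ) (e : Fin n → ℝ) (ω : Fin s → P.Coin) (j : Fin s) :
    List (Word n) :=
  P.answer j (x j) e (ω j) (P.queries x e ω j)

/-- The value that the coordinator computes. -/
def result (x : Fin s → Fin n → ℝ) (e : Fin n → ℝ) (ω : Fin s → P.Coin) : ℝ :=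
  P.output e (P.reports x e ω) (P.answers x e ω)

/-- The total number of words sent, in both directions. -/
def communication (x : Fin s → Fin n → ℝ) (e : Fin n → ℝ) (ω : Fin s → P.Coin) : ℕ :=
  ∑ j, ((P.reports x e ω j).length + (P.queries x e ω j).length + (P.answers x e ω j).length)

/-- Every real number that is sent is a number that its sender holds: for a server one of its
`localNumbers` (or a number received), for the coordinator a number received. So a word cannot be
used to pack a whole vector into one real number. -/
def NumbersAreHeld (f : ℝ → ℝ) (x : Fin s → Fin n → ℝ) (e : Fin n → ℝ) (ω : Fin s → P.Coin) :
    Prop :=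
  (∀ j, numbersIn (P.reports x e ω j) ⊆ localNumbers f e (x j)) ∧
  (∀ j, numbersIn (P.queries x e ω j) ⊆ ⋃ j', numbersIn (P.reports x e ω j')) ∧
  (∀ j, numbersIn (P.answers x e ω j) ⊆
    localNumbers f e (x j) ∪ numbersIn (P.queries x e ω j))

/-- The joint law of the shared independent standard exponentials and of the servers' coins, which
are independent of each other and of the exponentials. -/
def law : Measure ((Fin n → ℝ) × (Fin s → P.Coin)) :=
  (Measure.pi fun _ : Fin n => expMeasure 1).prod (Measure.pi fun _ : Fin s => P.coinLaw)

end TwoRoundProtocol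

/-- `A = O(log (s / ε₁) / log θ)` with constant `K`. -/
def bucketsA (K : ℝ) (s : ℕ) (θ ε₁ : ℝ) : ℕ :=
  ⌈K * (Real.log (s / ε₁) / Real.log θ)⌉₊

/-- `B = O(log (s² / (ε₁ (1 - ε₂))) / log θ)` with constant `K`. -/
def bucketsB (K : ℝ) (s : ℕ) (θ ε₁ ε₂ : ℝ) : ℕ :=
  ⌈K * (Real.log ((s : ℝ) ^ 2 / (ε₁ * (1 - ε₂))) / Real.log θ)⌉₊

/-- The communication bound, with `m = A · B` and without the leading constant. -/
def wordBound (f : ℝ → ℝ) (n s m : ℕ) (θ θ'' ε₁ ε₂ : ℝ) : ℝ :=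
  cf f s * (cf f m * m * √θ * Real.log n ^ 4 / (ε₁ * (1 - ε₂) ^ 2)) +
    s * (Real.log n ^ 2 * θ'' / (1 - ε₂) ^ 3)

end

/-! Write `w i = f (x i) / e i` for the total vector `x`, and `M` for the maximum of `w`. By the
exponential scaling, `∑ w i ≤ D * M` with `D = O(log² n)` with high probability
(`measure_compl_scaledSumGood`), so only few coordinates come close to the maximum.

Each server draws `N` coordinates with probabilities proportional to its own weights and reports
them with its normalisation. Dividing a drawn entry by its expected number of draws gives an
unbiased estimate of `x i`, but rarely drawn entries produce heavy tails. The sum is therefore cut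
at the largest level that at least `L = O(log n)` draws reach, after which Chernoff's bound applies.
The cut sum, halved, rarely exceeds `x i` (`measure_drawEstimate_gt`).

At the maximiser it is not too small either (`measure_map_drawEstimate_lt`). `exists_threshold`
gives a level such that the servers at or above it hold a part whose `f` exceeds `ε₁ * f x`, while
those at or below it keep `(1 - ε₂) * f x`. By Cauchy-Schwarz and the definition of `c_f[s]` the
first group is drawn often enough for the level to be admitted (`le_sum_sampling_prob`), so the
second group is counted in full up to a constant factor.

Hence a coordinate that scores at least as high as the maximiser satisfies `w i ≥ (1 - ε₂) / θ'' *
M`, and there are at most `D * θ'' / (1 - ε₂)` of these (`candidates_correct`). The second round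
fetches their exact entries. -/

noncomputable section

/-! ### Chernoff bounds for sums of independent `[0, 1]`-valued variables -/

section Concentration

variable {Ω κ : Type*} [MeasurableSpace Ω] {μ : Measure Ω} [Fintype κ]

/-- The chord of the exponential over `[0, 1]` lies above its graph. -/
theorem exp_mul_le_chord (t : ℝ) {u : ℝ} (h0 : 0 ≤ u) (h1 : u ≤ 1) :
    Real.exp (t * u) ≤ 1 + (Real.exp t - 1) * u := by
  have h := convexOn_exp.2 (Set.mem_univ t) (Set.mem_univ 0) h0 (sub_nonneg.2 h1)
    (by ring : u + (1 - u) = 1)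
  simp only [smul_eq_mul, mul_zero, add_zero, Real.exp_zero, mul_one] at h
  rw [mul_comm t u]
  linarith

theorem integrable_of_mem_unit [IsFiniteMeasure μ] {X : Ω → ℝ} (hm : Measurable X)
    (h0 : ∀ ω, 0 ≤ X ω) (h1 : ∀ ω, X ω ≤ 1) : Integrable X μ :=
  Integrable.of_bound hm.aestronglyMeasurable 1
    (Filter.Eventually.of_forall fun ω => by rw [Real.norm_of_nonneg (h0 ω)]; exact h1 ω)

/-- The chord bound followed by `1 + u ≤ exp u`: the variable is dominated by a Poisson variable of
the same mean, and such bounds multiply over independent variables. -/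
theorem mgf_le_of_mem_unit [IsProbabilityMeasure μ] {X : Ω → ℝ} (hm : Measurable X)
    (h0 : ∀ ω, 0 ≤ X ω) (h1 : ∀ ω, X ω ≤ 1) (t : ℝ) :
    mgf X μ t ≤ Real.exp ((Real.exp t - 1) * ∫ ω, X ω ∂μ) := by
  have hi := integrable_of_mem_unit (μ := μ) hm h0 h1
  have hi' : Integrable (fun ω => 1 + (Real.exp t - 1) * X ω) μ :=
    (integrable_const _).add (hi.const_mul _)
  calc mgf X μ t ≤ ∫ ω, (1 + (Real.exp t - 1) * X ω) ∂μ :=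
        integral_mono_of_nonneg (Filter.Eventually.of_forall fun ω => (Real.exp_pos _).le) hi'
          (Filter.Eventually.of_forall fun ω => exp_mul_le_chord t (h0 ω) (h1 ω))
    _ = (Real.exp t - 1) * ∫ ω, X ω ∂μ + 1 := by
        rw [integral_add (integrable_const _) (hi.const_mul _), integral_const_mul]
        simp [add_comm]
    _ ≤ _ := Real.add_one_le_exp _

theorem mgf_sum_le_of_mem_unit {X : κ → Ω → ℝ} (hX : iIndepFun X μ) (hm : ∀ k, Measurable (X k))
    (h0 : ∀ k ω, 0 ≤ X k ω) (h1 : ∀ k ω, X k ω ≤ 1) (t : ℝ) :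
    mgf (∑ k, X k) μ t ≤ Real.exp ((Real.exp t - 1) * ∑ k, ∫ ω, X k ω ∂μ) := by
  have := hX.isProbabilityMeasure
  rw [hX.mgf_sum hm, Finset.mul_sum, Real.exp_sum]
  exact Finset.prod_le_prod (fun k _ => mgf_nonneg)
    fun k _ => mgf_le_of_mem_unit (hm k) (h0 k) (h1 k) t

theorem integrable_exp_sum_of_mem_unit [IsFiniteMeasure μ] {X : κ → Ω → ℝ}
    (hm : ∀ k, Measurable (X k)) (h0 : ∀ k ω, 0 ≤ X k ω) (h1 : ∀ k ω, X k ω ≤ 1) (t : ℝ) :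
    Integrable (fun ω => Real.exp (t * (∑ k, X k) ω)) μ := by
  have hms : Measurable (∑ k, X k) := by
    rw [Finset.sum_fn]
    exact Finset.univ.measurable_sum fun k _ => hm k
  refine Integrable.of_bound (hms.const_mul t).exp.aestronglyMeasurable
    (Real.exp (|t| * Fintype.card κ)) (Filter.Eventually.of_forall fun ω => ?_)
  rw [Real.norm_of_nonneg (Real.exp_pos _).le, Real.exp_le_exp, Finset.sum_apply]
  have hs0 : 0 ≤ ∑ k, X k ω := Finset.sum_nonneg fun k _ => h0 k ω
  have hs1 : ∑ k, X k ω ≤ Fintype.card κ := by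
    calc ∑ k, X k ω ≤ ∑ _k : κ, (1 : ℝ) := Finset.sum_le_sum fun k _ => h1 k ω
      _ = _ := by simp
  calc t * ∑ k, X k ω ≤ |t| * ∑ k, X k ω := by gcongr; exact le_abs_self t
    _ ≤ _ := by gcongr

/-- Chernoff's bound for the upper tail of a sum of independent `[0, 1]`-valued variables. -/
theorem measure_le_sum_le_exp {X : κ → Ω → ℝ} (hX : iIndepFun X μ) (hm : ∀ k, Measurable (X k))
    (h0 : ∀ k ω, 0 ≤ X k ω) (h1 : ∀ k ω, X k ω ≤ 1) {m : ℝ} (hmean : ∑ k, ∫ ω, X k ω ∂μ ≤ m)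
    (a : ℝ) : μ.real {ω | a ≤ ∑ k, X k ω} ≤ Real.exp ((Real.exp 1 - 1) * m - a) := by
  have := hX.isProbabilityMeasure
  have h := measure_ge_le_exp_mul_mgf a zero_le_one
    (integrable_exp_sum_of_mem_unit (μ := μ) hm h0 h1 1)
  simp only [Finset.sum_apply] at h
  have he : 0 ≤ Real.exp 1 - 1 := by linarith [Real.add_one_le_exp 1]
  calc _ ≤ _ := h
    _ ≤ Real.exp (-1 * a) * Real.exp ((Real.exp 1 - 1) * m) := by
        gcongr
        refine (mgf_sum_le_of_mem_unit hX hm h0 h1 1).trans ?_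
        gcongr
    _ = _ := by rw [← Real.exp_add]; ring_nf

/-- Chernoff's bound for the lower tail of a sum of independent `[0, 1]`-valued variables. -/
theorem measure_sum_le_le_exp {X : κ → Ω → ℝ} (hX : iIndepFun X μ) (hm : ∀ k, Measurable (X k))
    (h0 : ∀ k ω, 0 ≤ X k ω) (h1 : ∀ k ω, X k ω ≤ 1) {m : ℝ} (hmean : m ≤ ∑ k, ∫ ω, X k ω ∂μ)
    (a : ℝ) : μ.real {ω | ∑ k, X k ω ≤ a} ≤ Real.exp (a - (1 - Real.exp (-1)) * m) := by
  have := hX.isProbabilityMeasure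
  have h := measure_le_le_exp_mul_mgf a (by norm_num : (-1 : ℝ) ≤ 0)
    (integrable_exp_sum_of_mem_unit (μ := μ) hm h0 h1 (-1))
  simp only [Finset.sum_apply] at h
  have he : Real.exp (-1) - 1 ≤ 0 := by
    linarith [Real.exp_le_one_iff.2 (by norm_num : (-1 : ℝ) ≤ 0)]
  calc _ ≤ _ := h
    _ ≤ Real.exp (- -1 * a) * Real.exp ((Real.exp (-1) - 1) * m) := by
        gcongr
        refine (mgf_sum_le_of_mem_unit hX hm h0 h1 (-1)).trans ?_
        rw [Real.exp_le_exp]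
        exact mul_le_mul_of_nonpos_left hmean he
    _ = _ := by rw [← Real.exp_add]; ring_nf

theorem measure_two_mul_le_sum {X : κ → Ω → ℝ} (hX : iIndepFun X μ) (hm : ∀ k, Measurable (X k))
    (h0 : ∀ k ω, 0 ≤ X k ω) (h1 : ∀ k ω, X k ω ≤ 1) {L : ℝ}
    (hmean : L / 2 ≤ ∑ k, ∫ ω, X k ω ∂μ) :
    μ.real {ω | 2 * ∑ k, ∫ ω, X k ω ∂μ ≤ ∑ k, X k ω} ≤ Real.exp (-(L / 8)) := by
  refine (measure_le_sum_le_exp hX hm h0 h1 le_rfl _).trans (Real.exp_le_exp.2 ?_)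
  have hnn : 0 ≤ ∑ k, ∫ ω, X k ω ∂μ := Finset.sum_nonneg fun k _ => integral_nonneg (h0 k)
  -- The exponent is `(e - 3)` times a mean of at least `L / 2`, and `(3 - e) / 2 > 1 / 8`.
  nlinarith [Real.exp_one_lt_d9]

theorem measure_le_sum_of_mean_le {X : κ → Ω → ℝ} (hX : iIndepFun X μ)
    (hm : ∀ k, Measurable (X k)) (h0 : ∀ k ω, 0 ≤ X k ω) (h1 : ∀ k ω, X k ω ≤ 1) {L : ℝ}
    (hL : 0 ≤ L) (hmean : ∑ k, ∫ ω, X k ω ∂μ ≤ L / 2) :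
    μ.real {ω | L ≤ ∑ k, X k ω} ≤ Real.exp (-(L / 8)) := by
  refine (measure_le_sum_le_exp hX hm h0 h1 hmean _).trans (Real.exp_le_exp.2 ?_)
  nlinarith [Real.exp_one_lt_d9]

theorem exp_neg_one_lt : Real.exp (-1) < 3 / 8 := by
  rw [Real.exp_neg, inv_lt_comm₀ (Real.exp_pos 1) (by norm_num)]
  linarith [Real.exp_one_gt_d9]

theorem measure_sum_le_half {X : κ → Ω → ℝ} (hX : iIndepFun X μ) (hm : ∀ k, Measurable (X k))
    (h0 : ∀ k ω, 0 ≤ X k ω) (h1 : ∀ k ω, X k ω ≤ 1) {L : ℝ} (hL : 0 ≤ L)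
    (hmean : 2 * L ≤ ∑ k, ∫ ω, X k ω ∂μ) :
    μ.real {ω | ∑ k, X k ω ≤ (∑ k, ∫ ω, X k ω ∂μ) / 2} ≤ Real.exp (-(L / 8)) := by
  refine (measure_sum_le_le_exp hX hm h0 h1 le_rfl _).trans (Real.exp_le_exp.2 ?_)
  -- Since `1 - exp (-1) > 5 / 8`, the exponent is at most `-1 / 8` of the mean.
  nlinarith [exp_neg_one_lt]

end Concentration

/-! ### Sums truncated at a level chosen from the data -/

section Winsor

variable {κ : Type*} [Fintype κ]

/-- The sum of `ρ` after cutting its values down to the largest value `τ` that is reached by at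
least `L` of them. -/
def winsorSum (L : ℝ) (ρ : κ → ℝ) : ℝ :=
  ⨆ k, if 0 < ρ k ∧ L ≤ ∑ k', (if ρ k ≤ ρ k' then (1 : ℝ) else 0)
    then ∑ k', min (ρ k') (ρ k) else 0

theorem winsorSum_le {L b : ℝ} {ρ : κ → ℝ} (hb : 0 ≤ b)
    (h : ∀ k, 0 < ρ k → L ≤ ∑ k', (if ρ k ≤ ρ k' then (1 : ℝ) else 0) →
      ∑ k', min (ρ k') (ρ k) ≤ b) : winsorSum L ρ ≤ b := by
  refine Real.iSup_le (fun k => ?_) hb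
  split_ifs with hk
  · exact h k hk.1 hk.2
  · exact hb

theorem winsorSum_nonneg {L : ℝ} {ρ : κ → ℝ} (hρ : ∀ k, 0 ≤ ρ k) : 0 ≤ winsorSum L ρ := by
  refine Real.iSup_nonneg fun k => ?_
  split_ifs with hk
  · exact Finset.sum_nonneg fun k' _ => le_min (hρ _) (hρ _)
  · exact le_rfl

/-- A level that is not itself a value can be raised to the smallest value above it: the same terms
reach it, and the cut sum only grows. -/
theorem le_winsorSum {L τ : ℝ} {ρ : κ → ℝ} (hL : 0 < L) (hτ : 0 < τ)
    (h : L ≤ ∑ k', (if τ ≤ ρ k' then (1 : ℝ) else 0)) :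
    ∑ k', min (ρ k') τ ≤ winsorSum L ρ := by
  classical
  have hne : (Finset.univ.filter fun k => τ ≤ ρ k).Nonempty := by
    by_contra hn
    rw [Finset.not_nonempty_iff_eq_empty, Finset.filter_eq_empty_iff] at hn
    have : ∑ k', (if τ ≤ ρ k' then (1 : ℝ) else 0) = 0 :=
      Finset.sum_eq_zero fun k hk => if_neg (hn hk)
    linarith
  obtain ⟨k, hk, hmin⟩ := Finset.exists_min_image _ ρ hne
  have hk' : τ ≤ ρ k := (Finset.mem_filter.1 hk).2
  have hc : L ≤ ∑ k', (if ρ k ≤ ρ k' then (1 : ℝ) else 0) := by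
    refine h.trans (Finset.sum_le_sum fun k' _ => ?_)
    by_cases h1 : τ ≤ ρ k'
    · rw [if_pos h1, if_pos (hmin k' (by simp [h1]))]
    · rw [if_neg h1]; split_ifs <;> norm_num
  refine le_trans ?_ (le_ciSup (Set.finite_range _).bddAbove k)
  rw [if_pos ⟨hτ.trans_le hk', hc⟩]
  gcongr

theorem measurable_winsorSum {α : Type*} [MeasurableSpace α] (L : ℝ) {ρ : α → κ → ℝ}
    (hρ : ∀ k, Measurable fun a => ρ a k) : Measurable fun a => winsorSum L (ρ a) := by
  have hc : ∀ k, Measurable fun a => ∑ k', (if ρ a k ≤ ρ a k' then (1 : ℝ) else 0) := fun k =>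
    Finset.univ.measurable_sum fun k' _ =>
      Measurable.ite (measurableSet_le (hρ k) (hρ k')) measurable_const measurable_const
  refine Measurable.iSup fun k => Measurable.ite ?_ ?_ measurable_const
  · exact (measurableSet_lt measurable_const (hρ k)).inter (measurableSet_le measurable_const (hc k))
  · exact Finset.univ.measurable_sum fun k' _ => (hρ k').min (hρ k)

variable {Ω : Type*} [MeasurableSpace Ω] {μ : Measure Ω}

/-- A truncated Horvitz-Thompson sum rarely exceeds twice the sum that it estimates. -/
theorem measure_winsorSum_gt {Z : κ → Ω → ℝ} (hZ : iIndepFun Z μ) (hm : ∀ k, Measurable (Z k))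
    (h01 : ∀ k ω, Z k ω = 0 ∨ Z k ω = 1) {r : κ → ℝ} (hr : ∀ k, 0 ≤ r k) {L : ℝ} (hL : 0 < L) :
    μ.real {ω | 2 * ∑ k, r k * ∫ ω, Z k ω ∂μ < winsorSum L fun k => r k * Z k ω} ≤
      2 * Real.exp (-(L / 8)) := by
  classical
  have := hZ.isProbabilityMeasure
  have hZ0 : ∀ k ω, 0 ≤ Z k ω := fun k ω => by rcases h01 k ω with h | h <;> simp [h]
  have hZ1 : ∀ k ω, Z k ω ≤ 1 := fun k ω => by rcases h01 k ω with h | h <;> simp [h]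
  have hE0 : ∀ k, 0 ≤ ∫ ω, Z k ω ∂μ := fun k => integral_nonneg (hZ0 k)
  set E : κ → ℝ := fun k => ∫ ω, Z k ω ∂μ with hE
  -- The levels that are reached by at least `L / 2` draws in expectation; `τ` is the largest of
  -- them, or `0` if there is none.
  set V : Finset κ := Finset.univ.filter fun k =>
    0 < r k ∧ L / 2 ≤ ∑ k', (if r k ≤ r k' then E k' else 0) with hV
  obtain ⟨τ, hτ0, hτV, hτ⟩ : ∃ τ, 0 ≤ τ ∧ (∀ k ∈ V, r k ≤ τ) ∧
      (τ = 0 ∨ 0 < τ ∧ L / 2 ≤ ∑ k', (if τ ≤ r k' then E k' else 0)) := by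
    rcases V.eq_empty_or_nonempty with h | h
    · exact ⟨0, le_rfl, by simp [h], Or.inl rfl⟩
    · obtain ⟨k, hk, hmax⟩ := V.exists_max_image r h
      exact ⟨r k, hr k, hmax, Or.inr (Finset.mem_filter.1 hk).2⟩
  set X₁ : κ → Ω → ℝ := fun k ω => (if τ < r k then (1 : ℝ) else 0) * Z k ω with hX₁
  set X₂ : κ → Ω → ℝ := fun k ω => min (r k) τ / τ * Z k ω with hX₂
  have hi : ∀ c : κ → ℝ, iIndepFun (fun k ω => c k * Z k ω) μ := fun c =>
    hZ.comp (fun k z => c k * z) fun k => measurable_const.mul measurable_id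
  -- The smallest ratio above `τ` is not in `V`, so fewer than `L / 2` draws above `τ` are expected.
  have hX₁mean : ∑ k, ∫ ω, X₁ k ω ∂μ ≤ L / 2 := by
    simp only [hX₁, integral_const_mul]
    rcases (Finset.univ.filter fun k => τ < r k).eq_empty_or_nonempty with h | h
    · rw [Finset.filter_eq_empty_iff] at h
      rw [Finset.sum_eq_zero fun k hk => by rw [if_neg (h hk), zero_mul]]
      linarith
    · obtain ⟨k, hk, hmin⟩ := Finset.exists_min_image _ r h
      have hk' : τ < r k := (Finset.mem_filter.1 hk).2
      have hkV : k ∉ V := fun hc => absurd (hτV k hc) (not_le.2 hk')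
      have hlt : ∑ k', (if r k ≤ r k' then E k' else 0) < L / 2 := by
        by_contra hc
        exact hkV (Finset.mem_filter.2 ⟨Finset.mem_univ _, hτ0.trans_lt hk', not_lt.1 hc⟩)
      refine le_trans (Finset.sum_le_sum fun k' _ => ?_) hlt.le
      by_cases h1 : τ < r k'
      · rw [if_pos h1, if_pos (hmin k' (by simp [h1])), one_mul]
      · rw [if_neg h1, zero_mul]; split_ifs; exacts [hE0 _, le_rfl]
  have hev₁ := measure_le_sum_of_mean_le (X := X₁) (hi _) (fun k => (hm k).const_mul _)
    (fun k ω => by simp only [hX₁]; split_ifs <;> simp [hZ0 k ω])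
    (fun k ω => by simp only [hX₁]; split_ifs <;> simp [hZ1 k ω]) hL.le hX₁mean
  -- Once fewer than `L` draws lie above `τ`, no level above `τ` is admissible, so the random level
  -- is at most the deterministic `τ`.
  have key : ∀ ω, ∑ k, X₁ k ω < L → ∀ k, 0 < r k * Z k ω →
      L ≤ ∑ k', (if r k * Z k ω ≤ r k' * Z k' ω then (1 : ℝ) else 0) → r k * Z k ω ≤ τ := by
    intro ω hω k hk hc
    by_contra hlt
    rw [not_le] at hlt
    refine absurd (hc.trans (Finset.sum_le_sum fun k' _ => ?_)) (not_le.2 hω)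
    simp only [hX₁]
    split_ifs with h1 h2 h2
    · rcases h01 k' ω with h | h
      · rw [h, mul_zero] at h1; linarith
      · rw [h]; norm_num
    · rcases h01 k' ω with h | h
      · rw [h, mul_zero] at h1; linarith
      · rw [h, mul_one] at h1; linarith
    · simpa using hZ0 k' ω
    · simp
  have hb0 : 0 ≤ 2 * ∑ k, r k * E k :=
    mul_nonneg zero_le_two (Finset.sum_nonneg fun k _ => mul_nonneg (hr k) (hE0 k))
  rcases hτ with rfl | ⟨hτp, hτP⟩
  · refine (measureReal_mono (fun ω hω => ?_)).trans (hev₁.trans ?_)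
    · by_contra hc
      refine absurd (winsorSum_le hb0 fun k hk hk' => ?_) (not_le.2 hω)
      exact absurd (key ω (not_le.1 hc) k hk hk') (not_le.2 hk)
    · linarith [Real.exp_pos (-(L / 8))]
  -- Cut at `τ` and divided by `τ`, the terms lie in `[0, 1]` and their total mean is at least `L /
  -- 2`.
  · have hX₂1 : ∀ k, min (r k) τ / τ ≤ 1 := fun k => (div_le_one hτp).2 (min_le_right _ _)
    have hX₂0 : ∀ k, 0 ≤ min (r k) τ / τ := fun k => div_nonneg (le_min (hr k) hτ0) hτ0
    have hX₂mean : ∑ k, ∫ ω, X₂ k ω ∂μ = (∑ k, min (r k) τ * E k) / τ := by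
      simp only [hX₂, integral_const_mul, Finset.sum_div]
      exact Finset.sum_congr rfl fun k _ => by ring
    have hev₂ := measure_two_mul_le_sum (X := X₂) (L := L) (hi _) (fun k => (hm k).const_mul _)
      (fun k ω => mul_nonneg (hX₂0 k) (hZ0 k ω))
      (fun k ω => mul_le_one₀ (hX₂1 k) (hZ0 k ω) (hZ1 k ω)) (by
        refine hτP.trans (Finset.sum_le_sum fun k _ => ?_)
        simp only [hX₂, integral_const_mul]
        split_ifs with h
        · rw [min_eq_right h, div_self hτp.ne', one_mul]
        · exact mul_nonneg (hX₂0 k) (hE0 k))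
    refine (measureReal_mono (s₂ := {ω | L ≤ ∑ k, X₁ k ω} ∪
      {ω | 2 * ∑ k, ∫ ω, X₂ k ω ∂μ ≤ ∑ k, X₂ k ω}) (fun ω hω => ?_)).trans
      ((measureReal_union_le _ _).trans ?_)
    · by_contra hc
      simp only [Set.mem_union, Set.mem_ofPred_eq, not_or, not_le] at hc
      refine absurd (winsorSum_le hb0 fun k hk hk' => ?_) (not_le.2 hω)
      have h1 := key ω hc.1 k hk hk'
      have h2 := hc.2
      rw [hX₂mean] at h2
      have h3 : ∑ k, X₂ k ω = (∑ k, min (r k) τ * Z k ω) / τ := by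
        simp only [hX₂, Finset.sum_div]
        exact Finset.sum_congr rfl fun k _ => by ring
      rw [h3, mul_div_assoc', div_lt_div_iff_of_pos_right hτp] at h2
      calc ∑ k', min (r k' * Z k' ω) (r k * Z k ω) ≤ ∑ k', min (r k') τ * Z k' ω := by
            refine Finset.sum_le_sum fun k' _ => ?_
            rcases h01 k' ω with h | h
            · rw [h]; simp
            · rw [h]; simp only [mul_one]; exact min_le_min_left _ h1
        _ ≤ 2 * ∑ k, min (r k) τ * E k := h2.le
        _ ≤ 2 * ∑ k, r k * E k := by
            gcongr with k
            · exact hE0 k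
            · exact min_le_left _ _
    · linarith

/-- A truncated Horvitz-Thompson sum rarely falls below half of the sum of the truncated terms. -/
theorem measure_winsorSum_lt {Z : κ → Ω → ℝ} (hZ : iIndepFun Z μ) (hm : ∀ k, Measurable (Z k))
    (h01 : ∀ k ω, Z k ω = 0 ∨ Z k ω = 1) {r : κ → ℝ} (hr : ∀ k, 0 ≤ r k) {L τ : ℝ} (hL : 0 < L)
    (hτ : 0 < τ) (hP : 2 * L ≤ ∑ k, if τ ≤ r k then ∫ ω, Z k ω ∂μ else 0) :
    μ.real {ω | (winsorSum L fun k => r k * Z k ω) < (∑ k, min (r k) τ * ∫ ω, Z k ω ∂μ) / 2} ≤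
      2 * Real.exp (-(L / 8)) := by
  have := hZ.isProbabilityMeasure
  have hZ0 : ∀ k ω, 0 ≤ Z k ω := fun k ω => by rcases h01 k ω with h | h <;> simp [h]
  have hZ1 : ∀ k ω, Z k ω ≤ 1 := fun k ω => by rcases h01 k ω with h | h <;> simp [h]
  have hE0 : ∀ k, 0 ≤ ∫ ω, Z k ω ∂μ := fun k => integral_nonneg (hZ0 k)
  set X₁ : κ → Ω → ℝ := fun k ω => (if τ ≤ r k then (1 : ℝ) else 0) * Z k ω with hX₁
  set X₂ : κ → Ω → ℝ := fun k ω => min (r k) τ / τ * Z k ω with hX₂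
  have hi : ∀ c : κ → ℝ, iIndepFun (fun k ω => c k * Z k ω) μ := fun c =>
    hZ.comp (fun k z => c k * z) fun k => measurable_const.mul measurable_id
  have hX₁mean : ∑ k, ∫ ω, X₁ k ω ∂μ = ∑ k, if τ ≤ r k then ∫ ω, Z k ω ∂μ else 0 := by
    simp only [hX₁, integral_const_mul]
    simp only [ite_mul, one_mul, zero_mul]
  have hX₂mean : ∑ k, ∫ ω, X₂ k ω ∂μ = (∑ k, min (r k) τ * ∫ ω, Z k ω ∂μ) / τ := by
    simp only [hX₂, integral_const_mul, Finset.sum_div]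
    exact Finset.sum_congr rfl fun k _ => by ring
  have hX₂1 : ∀ k, min (r k) τ / τ ≤ 1 := fun k => (div_le_one hτ).2 (min_le_right _ _)
  have hX₂0 : ∀ k, 0 ≤ min (r k) τ / τ := fun k => div_nonneg (le_min (hr k) hτ.le) hτ.le
  have hev₁ := measure_sum_le_half (X := X₁) (hi _) (fun k => (hm k).const_mul _)
    (fun k ω => by simp only [hX₁]; split_ifs <;> simp [hZ0 k ω])
    (fun k ω => by simp only [hX₁]; split_ifs <;> simp [hZ1 k ω]) hL.le (hX₁mean ▸ hP)
  have hev₂ := measure_sum_le_half (X := X₂) (hi _) (fun k => (hm k).const_mul _)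
    (fun k ω => mul_nonneg (hX₂0 k) (hZ0 k ω))
    (fun k ω => mul_le_one₀ (hX₂1 k) (hZ0 k ω) (hZ1 k ω)) hL.le (by
      refine hP.trans (Finset.sum_le_sum fun k _ => ?_)
      simp only [hX₂, integral_const_mul]
      split_ifs with h
      · rw [min_eq_right h, div_self hτ.ne', one_mul]
      · exact mul_nonneg (hX₂0 k) (hE0 k))
  rw [hX₁mean] at hev₁
  rw [hX₂mean] at hev₂
  refine (measureReal_mono (s₂ := _ ∪ _) (fun ω hω => ?_)).trans
    ((measureReal_union_le _ _).trans ((add_le_add hev₁ hev₂).trans_eq (two_mul _).symm))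
  by_contra hc
  simp only [Set.mem_union, Set.mem_ofPred_eq, not_or, not_le] at hc
  obtain ⟨h1, h2⟩ := hc
  have h3 : ∑ k, X₂ k ω = (∑ k, min (r k) τ * Z k ω) / τ := by
    simp only [hX₂, Finset.sum_div]
    exact Finset.sum_congr rfl fun k _ => by ring
  rw [h3, div_right_comm, div_lt_div_iff_of_pos_right hτ] at h2
  -- Of the at least `2 * L` draws expected at or above `τ`, at least half occur, so `τ` is an
  -- admissible level.
  have h4 : L ≤ ∑ k', (if τ ≤ r k' * Z k' ω then (1 : ℝ) else 0) := by
    refine (show L ≤ ∑ k, X₁ k ω by linarith).trans (Finset.sum_le_sum fun k _ => ?_)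
    simp only [hX₁]
    rcases h01 k ω with h | h
    · rw [h, mul_zero]; split_ifs <;> norm_num
    · rw [h, mul_one, mul_one]
  have h5 := le_winsorSum hL hτ h4
  have h6 : ∑ k, min (r k * Z k ω) τ = ∑ k, min (r k) τ * Z k ω := by
    refine Finset.sum_congr rfl fun k _ => ?_
    rcases h01 k ω with h | h <;> simp [h, hτ.le]
  rw [h6] at h5
  exact absurd hω (not_lt.2 (h2.le.trans h5))

end Winsor

/-! ### Scaling by independent exponentials -/

section Exponentials

instance isProbabilityMeasure_expMeasure_one : IsProbabilityMeasure (expMeasure 1) :=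
  isProbabilityMeasure_expMeasure one_pos

theorem expMeasure_real_Iic {x : ℝ} (hx : 0 ≤ x) :
    (expMeasure 1).real (Set.Iic x) = 1 - Real.exp (-x) := by
  rw [← cdf_eq_real, cdf_expMeasure_eq one_pos, if_pos hx, one_mul]

theorem expMeasure_real_Ioi {x : ℝ} (hx : 0 ≤ x) :
    (expMeasure 1).real (Set.Ioi x) = Real.exp (-x) := by
  rw [← Set.compl_Iic, probReal_compl_eq_one_sub measurableSet_Iic, expMeasure_real_Iic hx]
  ring

theorem ae_pos_expMeasure : ∀ᵐ x ∂expMeasure 1, 0 < x := by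
  have h : expMeasure 1 (Set.Iic 0) = 0 := by
    rw [← measureReal_eq_zero_iff, expMeasure_real_Iic le_rfl]
    simp
  rw [ae_iff]
  simpa [Set.Iic] using h

theorem expMeasure_real_inv_mul_gt {p t : ℝ} (hp : 0 ≤ p) (ht : 0 < t) :
    (expMeasure 1).real {x | t < x⁻¹ * p} ≤ p / t := by
  have hsub : {x : ℝ | t < x⁻¹ * p} ⊆ Set.Iic (p / t) := by
    intro x hx
    have hx' : t < x⁻¹ * p := hx
    have hxp : 0 < x := by
      by_contra hn
      have : x⁻¹ * p ≤ 0 := mul_nonpos_of_nonpos_of_nonneg (inv_nonpos.2 (not_lt.1 hn)) hp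
      linarith
    rw [inv_mul_eq_div, lt_div_iff₀ hxp] at hx'
    exact (le_div_iff₀ ht).2 (by linarith)
  calc _ ≤ _ := measureReal_mono hsub
    _ = 1 - Real.exp (-(p / t)) := expMeasure_real_Iic (by positivity)
    _ ≤ p / t := by linarith [Real.add_one_le_exp (-(p / t))]

/-- `min 1` with dyadic steps. -/
theorem min_one_le_dyadic (u : ℝ) (l : ℕ) :
    min u 1 ≤ (1 / 2) ^ l +
      ∑ k ∈ Finset.range l, (1 / 2) ^ k * (if (1 / 2) ^ (k + 1) < u then (1 : ℝ) else 0) := by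
  induction l with
  | zero => simp
  | succ l ih =>
    by_cases h : (1 / 2 : ℝ) ^ (l + 1) < u
    · rw [Finset.sum_range_succ, if_pos h]
      have : (0 : ℝ) < (1 / 2) ^ (l + 1) := by positivity
      linarith
    · have h0 : 0 ≤ ∑ k ∈ Finset.range (l + 1),
          (1 / 2) ^ k * (if (1 / 2) ^ (k + 1) < u then (1 : ℝ) else 0) :=
        Finset.sum_nonneg fun k _ => by positivity
      linarith [min_le_left u 1, not_lt.1 h]

/-- `p / e`, cut off to `[0, 1]`. -/
def cutRatio (p e : ℝ) : ℝ := max 0 (min (e⁻¹ * p) 1)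

theorem cutRatio_nonneg (p e : ℝ) : 0 ≤ cutRatio p e := le_max_left _ _

theorem cutRatio_le_one (p e : ℝ) : cutRatio p e ≤ 1 := max_le zero_le_one (min_le_right _ _)

theorem measurable_cutRatio (p : ℝ) : Measurable (cutRatio p) := by
  unfold cutRatio; fun_prop

/-- The inverse of an exponential has infinite mean, hence the cut at `1`. Each dyadic scale
contributes at most `2 * p` by the tail bound `p / t`, so the mean grows only with the number `l` of
scales. -/
theorem integral_cutRatio_le {p : ℝ} (hp : 0 ≤ p) (l : ℕ) :
    ∫ e, cutRatio p e ∂expMeasure 1 ≤ (1 / 2) ^ l + 2 * l * p := by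
  have hms : ∀ t : ℝ, MeasurableSet {x : ℝ | t < x⁻¹ * p} := fun t =>
    measurableSet_lt measurable_const (measurable_inv.mul_const p)
  have hint : ∀ t : ℝ, Integrable (fun x : ℝ => if t < x⁻¹ * p then (1 : ℝ) else 0)
      (expMeasure 1) := fun t =>
    integrable_of_mem_unit (Measurable.ite (hms t) measurable_const measurable_const)
      (fun x => by split_ifs <;> norm_num) (fun x => by split_ifs <;> norm_num)
  have hval : ∀ t : ℝ, ∫ x, (if t < x⁻¹ * p then (1 : ℝ) else 0) ∂expMeasure 1 =
      (expMeasure 1).real {x | t < x⁻¹ * p} := fun t => by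
    rw [← integral_indicator_one (hms t)]
    rfl
  have hi' : Integrable (fun e : ℝ => (1 / 2 : ℝ) ^ l + ∑ k ∈ Finset.range l,
      (1 / 2) ^ k * (if (1 / 2) ^ (k + 1) < e⁻¹ * p then (1 : ℝ) else 0)) (expMeasure 1) :=
    (integrable_const _).add (integrable_finsetSum _ fun k _ => (hint _).const_mul _)
  calc ∫ e, cutRatio p e ∂expMeasure 1
      ≤ ∫ e, ((1 / 2 : ℝ) ^ l + ∑ k ∈ Finset.range l,
          (1 / 2) ^ k * (if (1 / 2) ^ (k + 1) < e⁻¹ * p then (1 : ℝ) else 0)) ∂expMeasure 1 := by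
        refine integral_mono (integrable_of_mem_unit (measurable_cutRatio p) (cutRatio_nonneg p)
          (cutRatio_le_one p)) hi' fun e => max_le ?_ (min_one_le_dyadic _ l)
        exact add_nonneg (by positivity) (Finset.sum_nonneg fun k _ => by positivity)
    _ = (1 / 2) ^ l + ∑ k ∈ Finset.range l,
          (1 / 2) ^ k * (expMeasure 1).real {x | (1 / 2) ^ (k + 1) < x⁻¹ * p} := by
        rw [integral_add (integrable_const _)
          (integrable_finsetSum _ fun k _ => (hint _).const_mul _),
          integral_finsetSum _ fun k _ => (hint _).const_mul _]
        simp only [integral_const_mul, hval]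
        simp
    _ ≤ (1 / 2) ^ l + ∑ _k ∈ Finset.range l, 2 * p := by
        refine add_le_add le_rfl (Finset.sum_le_sum fun k _ => ?_)
        refine (mul_le_mul_of_nonneg_left
          (expMeasure_real_inv_mul_gt (t := (1 / 2) ^ (k + 1)) hp (by positivity)) (by positivity)).trans_eq ?_
        rw [pow_succ]
        field_simp
    _ = _ := by rw [Finset.sum_const, Finset.card_range, nsmul_eq_mul]; ring

variable {n : ℕ}

/-- The scaled values `a i / e i` have a sum that is at most `D` times their maximum. -/
def scaledSumGood (D : ℝ) (a : Fin n → ℝ) : Set (Fin n → ℝ) :=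
  {e | (∀ i, 0 < e i) ∧ ∑ i, (e i)⁻¹ * a i ≤ D * ⨆ i, (e i)⁻¹ * a i}

theorem measurableSet_scaledSumGood (D : ℝ) (a : Fin n → ℝ) :
    MeasurableSet (scaledSumGood D a) := by
  refine MeasurableSet.inter (s₁ := {e : Fin n → ℝ | ∀ i, 0 < e i}) ?_ ?_
  · rw [Set.ofPred_forall]
    exact MeasurableSet.iInter fun i => measurableSet_lt measurable_const (measurable_pi_apply i)
  · refine measurableSet_le (by fun_prop) (Measurable.const_mul (Measurable.iSup fun i => ?_) D)
    fun_prop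

theorem ae_pos_pi_expMeasure :
    ∀ᵐ e ∂(Measure.pi fun _ : Fin n => expMeasure 1), ∀ i, 0 < e i := by
  rw [ae_all_iff]
  intro i
  have h := measurePreserving_eval (fun _ : Fin n => expMeasure 1) i
  exact h.quasiMeasurePreserving.ae ae_pos_expMeasure

theorem one_le_two_mul_log (hn : 2 ≤ n) : 1 ≤ 2 * Real.log n := by
  have h := Real.log_le_log (by norm_num : (0 : ℝ) < 2) (by exact_mod_cast hn : (2 : ℝ) ≤ n)
  linarith [Real.log_two_gt_d9]

theorem measure_sum_cutRatio_ge (hn : 2 ≤ n) {p : Fin n → ℝ} (hp : ∀ i, 0 ≤ p i)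
    (hsum : ∑ i, p i = 1) (t : ℝ) :
    (Measure.pi fun _ : Fin n => expMeasure 1).real
      {e | 16 * Real.log n + t ≤ ∑ i, cutRatio (p i) (e i)} ≤ Real.exp (-t) := by
  have hind : iIndepFun (fun i (e : Fin n → ℝ) => cutRatio (p i) (e i))
      (Measure.pi fun _ : Fin n => expMeasure 1) :=
    iIndepFun_pi fun i => (measurable_cutRatio (p i)).aemeasurable
  have hlog := one_le_two_mul_log hn
  have hn0 : (0 : ℝ) < n := by positivity
  have hmean : ∑ i, ∫ e : Fin n → ℝ, cutRatio (p i) (e i)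
      ∂(Measure.pi fun _ : Fin n => expMeasure 1) ≤ 8 * Real.log n := by
    -- With `2 ^ l ≥ n` the remainders `(1 / 2) ^ l` add up to at most `1` over all coordinates,
    -- while `l = O(log n)`.
    set l := Nat.clog 2 n
    have hl1 : (n : ℝ) ≤ 2 ^ l := by exact_mod_cast Nat.le_pow_clog one_lt_two n
    have hl2 : (l : ℝ) ≤ 3 * Real.log n := by
      have h1 : 2 ^ l.pred < n := Nat.pow_pred_clog_lt_self one_lt_two hn
      have h2 : (2 : ℝ) ^ l.pred ≤ n := by exact_mod_cast h1.le
      have h3 := Real.log_le_log (by positivity) h2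
      rw [Real.log_pow] at h3
      have h4 : (l : ℝ) ≤ l.pred + 1 := by
        have : l ≤ l.pred + 1 := by rw [Nat.pred_eq_sub_one]; omega
        exact_mod_cast this
      have h5 := Real.log_two_gt_d9
      have h6 : Real.log 2 ≤ Real.log n :=
        Real.log_le_log (by norm_num) (by exact_mod_cast hn)
      have h7 : (0 : ℝ) ≤ l.pred := by positivity
      nlinarith
    calc _ ≤ ∑ i, ((1 / 2 : ℝ) ^ l + 2 * l * p i) := by
          refine Finset.sum_le_sum fun i _ => ?_
          rw [integral_comp_eval (μ := fun _ : Fin n => expMeasure 1) (i := i)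
            (measurable_cutRatio (p i)).aestronglyMeasurable]
          exact integral_cutRatio_le (hp i) l
      _ = n * (1 / 2) ^ l + 2 * l := by
          rw [Finset.sum_add_distrib, ← Finset.mul_sum, hsum]
          simp
      _ ≤ 1 + 2 * l := by
          gcongr
          rw [one_div, inv_pow, ← div_eq_mul_inv]
          exact (div_le_one (by positivity)).2 hl1
      _ ≤ _ := by linarith
  refine (measure_le_sum_le_exp hind
    (fun i => (measurable_cutRatio (p i)).comp (measurable_pi_apply i))
    (fun i e => cutRatio_nonneg _ _) (fun i e => cutRatio_le_one _ _) hmean _).trans ?_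
  rw [Real.exp_le_exp]
  nlinarith [Real.exp_one_lt_d9]

/-- The event forces `e i > t * a i / F` for every `i`, and by independence these probabilities
multiply to `exp (-t)`: the minimum of exponentials is again exponential. -/
theorem measure_forall_inv_mul_lt {a : Fin n → ℝ} (ha : ∀ i, 0 ≤ a i) (hs : 0 < ∑ i, a i)
    {t : ℝ} (ht : 0 < t) :
    (Measure.pi fun _ : Fin n => expMeasure 1).real
      {e | (∀ i, 0 < e i) ∧ ∀ i, (e i)⁻¹ * a i < (∑ i, a i) / t} ≤ Real.exp (-t) := by
  set F := ∑ i, a i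
  have hsub : {e : Fin n → ℝ | (∀ i, 0 < e i) ∧ ∀ i, (e i)⁻¹ * a i < F / t} ⊆
      Set.univ.pi fun i => Set.Ioi (t * (a i / F)) := by
    rintro e ⟨he, h⟩ i -
    have h1 := h i
    rw [inv_mul_eq_div, div_lt_div_iff₀ (he i) ht] at h1
    rw [Set.mem_Ioi, mul_div_assoc', div_lt_iff₀ hs]
    linarith
  refine (measureReal_mono hsub).trans_eq ?_
  rw [Measure.real, Measure.pi_pi, ENNReal.toReal_prod]
  calc ∏ i, (expMeasure 1 (Set.Ioi (t * (a i / F)))).toReal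
      = ∏ i, Real.exp (-(t * (a i / F))) := Finset.prod_congr rfl fun i _ =>
        expMeasure_real_Ioi (mul_nonneg ht.le (div_nonneg (ha i) hs.le))
    _ = Real.exp (-t) := by
        rw [← Real.exp_sum, Finset.sum_neg_distrib, ← Finset.mul_sum, ← Finset.sum_div,
          div_self hs.ne', mul_one]

/-- With high probability the sum of the values `a i / e i` is at most `O(log² n)` times their
maximum. -/
theorem measure_compl_scaledSumGood (hn : 2 ≤ n) {a : Fin n → ℝ} (ha : ∀ i, 0 ≤ a i)
    (hs : 0 < ∑ i, a i) {T : ℝ} (hT : 0 < T) :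
    (Measure.pi fun _ : Fin n => expMeasure 1).real
      (scaledSumGood ((T + 2) * (T + 16) * Real.log n ^ 2) a)ᶜ ≤
      2 * Real.exp (-(T * Real.log n)) := by
  set F := ∑ i, a i with hF
  have hlog := one_le_two_mul_log hn
  have ht : 0 < T * Real.log n := by nlinarith
  have hpos : (Measure.pi fun _ : Fin n => expMeasure 1).real {e | ¬ ∀ i, 0 < e i} = 0 := by
    rw [measureReal_eq_zero_iff]
    exact ae_iff.1 ae_pos_pi_expMeasure
  have h1 := measure_forall_inv_mul_lt ha hs ht
  have h2 := measure_sum_cutRatio_ge hn (p := fun i => a i / F)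
    (fun i => div_nonneg (ha i) hs.le) (by rw [← Finset.sum_div, div_self hs.ne'])
    (T * Real.log n)
  refine (measureReal_mono (s₂ := {e | ¬ ∀ i, 0 < e i} ∪ ({e | (∀ i, 0 < e i) ∧
    ∀ i, (e i)⁻¹ * a i < F / (T * Real.log n)} ∪
    {e | 16 * Real.log n + T * Real.log n ≤ ∑ i, cutRatio (a i / F) (e i)}))
    (fun e he => ?_)).trans ((measureReal_union_le _ _).trans ?_)
  · by_contra hc
    simp only [Set.mem_union, Set.mem_ofPred_eq, not_or, not_not, not_and, not_le] at hc
    obtain ⟨hep, hM, hX⟩ := hc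
    have hM' := hM hep
    push Not at hM'
    obtain ⟨i₀, hi₀⟩ := hM'
    have hbdd : BddAbove (Set.range fun i => (e i)⁻¹ * a i) := (Set.finite_range _).bddAbove
    set M := ⨆ i, (e i)⁻¹ * a i with hMdef
    have hle : ∀ i, (e i)⁻¹ * a i ≤ M := fun i => le_ciSup hbdd i
    -- Some scaled value reaches `F / (T log n)`, so the unscaled sum is comparable with the
    -- maximum.
    have hFM : F ≤ T * Real.log n * M := by
      have := hi₀.trans (hle i₀)
      rw [div_le_iff₀ ht] at this
      linarith
    have hMp : 0 < M := by
      by_contra hn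
      nlinarith
    refine he ⟨hep, ?_⟩
    -- Below the cut a term equals `F` times its cut ratio; at the cut it is at most `M`.
    have hterm : ∀ i, (e i)⁻¹ * a i ≤ (F + M) * cutRatio (a i / F) (e i) := by
      intro i
      have hnn : 0 ≤ (e i)⁻¹ * (a i / F) :=
        mul_nonneg (inv_nonneg.2 (hep i).le) (div_nonneg (ha i) hs.le)
      have hcr : cutRatio (a i / F) (e i) = min ((e i)⁻¹ * (a i / F)) 1 :=
        max_eq_right (le_min hnn zero_le_one)
      rw [hcr]
      rcases le_total ((e i)⁻¹ * (a i / F)) 1 with h | h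
      · rw [min_eq_left h]
        have : (e i)⁻¹ * a i = F * ((e i)⁻¹ * (a i / F)) := by field_simp
        nlinarith
      · rw [min_eq_right h]
        linarith [hle i]
    have hX0 : 0 ≤ ∑ i, cutRatio (a i / F) (e i) :=
      Finset.sum_nonneg fun i _ => cutRatio_nonneg _ _
    calc ∑ i, (e i)⁻¹ * a i ≤ ∑ i, (F + M) * cutRatio (a i / F) (e i) :=
          Finset.sum_le_sum fun i _ => hterm i
      _ = (F + M) * ∑ i, cutRatio (a i / F) (e i) := by rw [Finset.mul_sum]
      _ ≤ ((T + 2) * Real.log n * M) * (16 * Real.log n + T * Real.log n) := by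
          gcongr
          nlinarith
      _ = _ := by ring
  · rw [hpos, zero_add]
    exact (measureReal_union_le _ _).trans ((add_le_add h1 h2).trans_eq (two_mul _).symm)

end Exponentials

/-! ### Consequences of approximate invertibility -/

namespace ApproxInvertible

variable {f : ℝ → ℝ} {θ θ' θ'' ε₁ ε₂ : ℝ}

theorem map_zero (h : ApproxInvertible f θ θ' θ'' ε₁ ε₂) : f 0 = 0 := by
  have h1 := h.superadd 0 0 le_rfl le_rfl
  have h2 := h.nonneg 0 le_rfl
  rw [add_zero] at h1
  linarith

theorem mono (h : ApproxInvertible f θ θ' θ'' ε₁ ε₂) {a b : ℝ} (ha : 0 ≤ a) (hab : a ≤ b) :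
    f a ≤ f b :=
  mono_of_superadd h.nonneg h.superadd ha hab

theorem four_lt_scale (h : ApproxInvertible f θ θ' θ'' ε₁ ε₂) : 4 < 4 * √θ * θ' := by
  have hsq : 1 ≤ √θ := by rw [Real.one_le_sqrt]; exact h.one_lt_theta.le
  nlinarith [h.one_lt_theta']

/-- If `f` is not identically zero, it is positive on the positive reals. -/
theorem map_pos (h : ApproxInvertible f θ θ' θ'' ε₁ ε₂) {z y : ℝ} (hz : 0 ≤ z) (hfz : 0 < f z)
    (hy : 0 < y) : 0 < f y := by
  have hρ := h.four_lt_scale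
  have hθ := h.one_lt_theta''
  set ρ := 4 * √θ * θ'
  by_contra hn
  have hpow : ∀ k : ℕ, f (ρ ^ k * y) ≤ 0 := by
    intro k
    induction k with
    | zero => simpa using not_lt.1 hn
    | succ k ih =>
      have hd := h.scale_down (ρ ^ (k + 1) * y) (by positivity)
      have e : ρ ^ (k + 1) * y / ρ = ρ ^ k * y := by
        rw [pow_succ]; field_simp
      rw [e] at hd
      have h1 : f (ρ ^ (k + 1) * y) / θ'' ≤ 0 := hd.trans ih
      rw [div_le_iff₀ (by linarith)] at h1
      linarith
  obtain ⟨k, hk⟩ := pow_unbounded_of_one_lt (z / y) (by linarith : 1 < ρ)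
  rw [div_lt_iff₀ hy] at hk
  linarith [h.mono hz hk.le, hpow k]

theorem cf_nonneg (h : ApproxInvertible f θ θ' θ'' ε₁ ε₂) {t : ℕ} (ht : 1 ≤ t) : 0 ≤ cf f t :=
  (h.isLeast_cf ht).1.1

/-- Entries outside `T` are replaced by zeros, which contribute nothing because `f 0 = 0`. -/
theorem map_sum_le_cf (h : ApproxInvertible f θ θ' θ'' ε₁ ε₂) {t : ℕ} (ht : 1 ≤ t)
    {y : Fin t → ℝ} (hy : ∀ j, 0 ≤ y j) (T : Finset (Fin t)) :
    f (∑ j ∈ T, y j) ≤ cf f t / t * (∑ j ∈ T, √(f (y j))) ^ 2 := by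
  have h1 := (h.isLeast_cf ht).1.2 (fun j => if j ∈ T then y j else 0)
    fun j => by split_ifs; exacts [hy j, le_rfl]
  have h2 : ∀ j, √(f (if j ∈ T then y j else 0)) = if j ∈ T then √(f (y j)) else 0 := fun j => by
    split_ifs
    · rfl
    · rw [h.map_zero, Real.sqrt_zero]
  simpa only [h2, Finset.sum_ite_mem, Finset.univ_inter] using h1

/-- Testing the definition on one entry `z` and zeros elsewhere gives `f z ≤ c / t * f z`. -/
theorem le_cf (h : ApproxInvertible f θ θ' θ'' ε₁ ε₂) {z : ℝ} (hz : 0 ≤ z) (hfz : 0 < f z)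
    {t : ℕ} (ht : 1 ≤ t) : (t : ℝ) ≤ cf f t := by
  have h1 := h.map_sum_le_cf ht (y := fun _ => z) (fun _ => hz) {⟨0, ht⟩}
  have ht0 : (0 : ℝ) < t := by exact_mod_cast ht
  rw [Finset.sum_singleton, Finset.sum_singleton, Real.sq_sqrt hfz.le, div_mul_eq_mul_div,
    le_div_iff₀ ht0, mul_comm] at h1
  exact le_of_mul_le_mul_right h1 hfz

theorem cf_eq_zero (h : ApproxInvertible f θ θ' θ'' ε₁ ε₂) (hf : ∀ z, 0 ≤ z → f z = 0) {t : ℕ}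
    (ht : 1 ≤ t) : cf f t = 0 := by
  refine le_antisymm ((h.isLeast_cf ht).2 ⟨le_rfl, fun y hy => ?_⟩) (h.cf_nonneg ht)
  rw [hf _ (Finset.sum_nonneg fun i _ => hy i)]
  positivity

/-- A threshold for the ratios `R` such that the entries with ratio above it are too many to be
neglected, while the entries with ratio strictly above it can be. -/
theorem exists_threshold (h : ApproxInvertible f θ θ' θ'' ε₁ ε₂) {κ : Type*} [Fintype κ]
    {y R : κ → ℝ} (hy : ∀ j, 0 ≤ y j) (hR : ∀ j, 0 < y j → 0 < R j) (hf : 0 < f (∑ j, y j)) :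
    ∃ τ, 0 < τ ∧ ε₁ * f (∑ j, y j) < f (∑ j with τ ≤ R j, y j) ∧
      (1 - ε₂) * f (∑ j, y j) ≤ f (∑ j with R j ≤ τ, y j) := by
  classical
  set x := ∑ j, y j with hx
  -- The threshold is the largest ratio for which the entries at or above it still exceed the
  -- fraction `ε₁`.
  set V : Finset κ := Finset.univ.filter fun j =>
    0 < R j ∧ ε₁ * f x < f (∑ j' with R j ≤ R j', y j') with hV
  have hpos : ∑ j with 0 < R j, y j = x := by
    refine Finset.sum_filter_of_ne fun j _ hj => hR j (lt_of_le_of_ne (hy j) (Ne.symm hj))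
  have hlt : ε₁ * f x < f x := by nlinarith [h.eps₁_lt_one]
  have hPne : (Finset.univ.filter fun j => 0 < R j).Nonempty := by
    by_contra hn
    rw [Finset.not_nonempty_iff_eq_empty.1 hn, Finset.sum_empty] at hpos
    rw [← hpos, h.map_zero] at hf
    exact lt_irrefl _ hf
  have hVne : V.Nonempty := by
    obtain ⟨j, hj, hmin⟩ := Finset.exists_min_image _ R hPne
    have hj' : 0 < R j := (Finset.mem_filter.1 hj).2
    refine ⟨j, Finset.mem_filter.2 ⟨Finset.mem_univ _, hj', ?_⟩⟩
    have : (Finset.univ.filter fun j' => R j ≤ R j') = Finset.univ.filter fun j' => 0 < R j' := by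
      ext j'
      simp only [Finset.mem_filter, Finset.mem_univ, true_and]
      exact ⟨fun h => hj'.trans_le h, fun h => hmin j' (by simp [h])⟩
    rw [this, hpos]
    exact hlt
  obtain ⟨j, hj, hmax⟩ := V.exists_max_image R hVne
  obtain ⟨hj0, hj1⟩ := (Finset.mem_filter.1 hj).2
  refine ⟨R j, hj0, hj1, ?_⟩
  have hsplit : ∑ j' with R j' ≤ R j, y j' = x - ∑ j' with R j < R j', y j' := by
    rw [eq_sub_iff_add_eq, hx,
      ← Finset.sum_filter_add_sum_filter_not Finset.univ (fun j' => R j' ≤ R j)]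
    simp only [not_le]
  rw [hsplit]
  refine h.sub_stable _ _ (Finset.sum_nonneg fun j' _ => hy j') ?_ ?_
  · exact Finset.sum_le_sum_of_subset_of_nonneg (Finset.filter_subset _ _) fun j' _ _ => hy j'
  -- The entries strictly above the threshold are those from the next larger ratio on. That ratio is
  -- not in `V`, so they are negligible and `sub_stable` permits their removal.
  · rcases (Finset.univ.filter fun j' => R j < R j').eq_empty_or_nonempty with hE | hE
    · rw [hE, Finset.sum_empty, h.map_zero]
      exact mul_nonneg h.eps₁_pos.le hf.le
    · obtain ⟨k, hk, hmin⟩ := Finset.exists_min_image _ R hE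
      have hk' : R j < R k := (Finset.mem_filter.1 hk).2
      have : (Finset.univ.filter fun j' => R j < R j') =
          Finset.univ.filter fun j' => R k ≤ R j' := by
        ext j'
        simp only [Finset.mem_filter, Finset.mem_univ, true_and]
        exact ⟨fun h => hmin j' (by simp [h]), fun h => hk'.trans_le h⟩
      rw [this]
      by_contra hc
      exact absurd (hmax k (Finset.mem_filter.2 ⟨Finset.mem_univ _, hj0.trans hk', not_le.1 hc⟩))
        (not_le.2 hk')

/-- The servers of `T` together sample a coordinate often if their part of it is a sizable
fraction. Here `F j` is the normalisation of server `j` and `e` the exponential of the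
coordinate. -/
theorem le_sum_sampling_prob (h : ApproxInvertible f θ θ' θ'' ε₁ ε₂) {s : ℕ} (hs : 1 ≤ s)
    {y F : Fin s → ℝ} (hy : ∀ j, 0 ≤ y j) {e D : ℝ} (he : 0 < e)
    (hF : ∀ j, e⁻¹ * f (y j) ≤ F j) (hsum : ∑ j, F j ≤ D * (e⁻¹ * f (∑ j, y j)))
    (hf : 0 < f (∑ j, y j)) {T : Finset (Fin s)}
    (hT : ε₁ * f (∑ j, y j) < f (∑ j ∈ T, y j)) :
    ε₁ * s ≤ cf f s * D * ∑ j ∈ T, e⁻¹ * f (y j) / F j := by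
  set x := ∑ j, y j
  have hs0 : (0 : ℝ) < s := by exact_mod_cast hs
  have hw : ∀ j, 0 ≤ e⁻¹ * f (y j) := fun j => mul_nonneg (inv_nonneg.2 he.le) (h.nonneg _ (hy j))
  have hF0 : ∀ j, 0 ≤ F j := fun j => (hw j).trans (hF j)
  have hq0 : ∀ j, 0 ≤ e⁻¹ * f (y j) / F j := fun j => div_nonneg (hw j) (hF0 j)
  -- Splits `f (y j)` into the sampling probability and `e * F j`, ready for Cauchy-Schwarz. If `F j
  -- = 0`, then `f (y j) = 0` and both sides vanish.
  have hsq : ∀ j, √(f (y j)) = √(e⁻¹ * f (y j) / F j) * √(e * F j) := by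
    intro j
    rw [← Real.sqrt_mul (hq0 j)]
    congr 1
    rcases (hF0 j).eq_or_lt with h0 | h0
    · have h1 : e⁻¹ * f (y j) = 0 := le_antisymm (h0 ▸ hF j) (hw j)
      have h2 : f (y j) = 0 := by
        rcases mul_eq_zero.1 h1 with h2 | h2
        · exact absurd h2 (inv_ne_zero he.ne')
        · exact h2
      rw [h2]; simp
    · field_simp
  have hcs : (∑ j ∈ T, √(f (y j))) ^ 2 ≤
      (∑ j ∈ T, e⁻¹ * f (y j) / F j) * (D * f x) := by
    simp only [hsq]
    refine (Finset.sum_mul_sq_le_sq_mul_sq _ _ _).trans ?_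
    simp only [Real.sq_sqrt (hq0 _), Real.sq_sqrt (mul_nonneg he.le (hF0 _))]
    refine mul_le_mul_of_nonneg_left ?_ (Finset.sum_nonneg fun j _ => hq0 j)
    calc ∑ j ∈ T, e * F j ≤ ∑ j, e * F j :=
          Finset.sum_le_sum_of_subset_of_nonneg (Finset.subset_univ _)
            fun j _ _ => mul_nonneg he.le (hF0 j)
      _ = e * ∑ j, F j := by rw [Finset.mul_sum]
      _ ≤ e * (D * (e⁻¹ * f x)) := by gcongr
      _ = D * f x := by field_simp
  have h1 := (hT.le.trans (h.map_sum_le_cf hs hy T)).trans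
    (mul_le_mul_of_nonneg_left hcs (div_nonneg (h.cf_nonneg hs) hs0.le))
  rw [div_mul_eq_mul_div, le_div_iff₀ hs0] at h1
  refine le_of_mul_le_mul_right ?_ hf
  linarith

end ApproxInvertible

/-! ### Drawing an index from a uniform coin -/

section Sampling

variable {n : ℕ}

/-- The point `u` of the unit interval falls into the `i`-th of the consecutive intervals whose
lengths are proportional to the weights `w`. -/
def Hits (w : Fin n → ℝ) (u : ℝ) (i : Fin n) : Prop :=
  ∑ i' ∈ Finset.Iio i, w i' ≤ u * ∑ i', w i' ∧ u * ∑ i', w i' < ∑ i' ∈ Finset.Iic i, w i'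

open Classical in
/-- The index drawn by `u` with probabilities proportional to the weights `w`. -/
def pick (w : Fin n → ℝ) (u : ℝ) : Option (Fin n) :=
  if h : ∃ i, Hits w u i then some h.choose else none

theorem Hits.le {w : Fin n → ℝ} (hw : ∀ i, 0 ≤ w i) {u : ℝ} {i i' : Fin n} (h : Hits w u i)
    (h' : Hits w u i') : i' ≤ i := by
  by_contra hlt
  rw [not_le] at hlt
  have hsub : Finset.Iic i ⊆ Finset.Iio i' := fun k hk =>
    Finset.mem_Iio.2 ((Finset.mem_Iic.1 hk).trans_lt hlt)
  have := Finset.sum_le_sum_of_subset_of_nonneg hsub fun k _ _ => hw k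
  linarith [h.2, h'.1]

theorem pick_eq_some_iff {w : Fin n → ℝ} (hw : ∀ i, 0 ≤ w i) {u : ℝ} {i : Fin n} :
    pick w u = some i ↔ Hits w u i := by
  unfold pick
  split_ifs with h
  · rw [Option.some_inj]
    exact ⟨fun hi => hi ▸ h.choose_spec, fun hi =>
      le_antisymm (hi.le hw h.choose_spec) (h.choose_spec.le hw hi)⟩
  · simp only [false_iff]
    exact fun hi => h ⟨i, hi⟩

/-- The uniform distribution on `[0, 1)`. -/
def uniformCoin : Measure ℝ := volume.restrict (Set.Ico 0 1)

instance isProbabilityMeasure_uniformCoin : IsProbabilityMeasure uniformCoin :=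
  ⟨by simp [uniformCoin]⟩

theorem uniformCoin_real_hits {w : Fin n → ℝ} (hw : ∀ i, 0 ≤ w i) (i : Fin n) :
    uniformCoin.real {u | Hits w u i} = w i / ∑ i', w i' := by
  have hIic : ∑ i' ∈ Finset.Iic i, w i' = ∑ i' ∈ Finset.Iio i, w i' + w i := by
    rw [← Finset.Iio_insert, Finset.sum_insert (by simp), add_comm]
  -- With zero total weight nothing is hit, because the upper inequality is strict; this agrees with
  -- `0 / 0 = 0`.
  rcases (Finset.sum_nonneg fun i _ => hw i : 0 ≤ ∑ i, w i).eq_or_lt with h0 | hW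
  · have hz : ∀ i, w i = 0 := fun i =>
      (Finset.sum_eq_zero_iff_of_nonneg fun i _ => hw i).1 h0.symm i (Finset.mem_univ i)
    simp [Hits, hz]
  have hset : {u : ℝ | Hits w u i} = Set.Ico ((∑ i' ∈ Finset.Iio i, w i') / ∑ i', w i')
      ((∑ i' ∈ Finset.Iic i, w i') / ∑ i', w i') := by
    ext u
    rw [Set.mem_Ico, div_le_iff₀ hW, lt_div_iff₀ hW]
    rfl
  have hsub : {u : ℝ | Hits w u i} ⊆ Set.Ico 0 1 := by
    rw [hset]
    refine Set.Ico_subset_Ico (div_nonneg (Finset.sum_nonneg fun i _ => hw i) hW.le) ?_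
    rw [div_le_one hW]
    exact Finset.sum_le_sum_of_subset_of_nonneg (Finset.subset_univ _) fun k _ _ => hw k
  rw [uniformCoin, Measure.real, Measure.restrict_apply (hset ▸ measurableSet_Ico),
    Set.inter_eq_left.2 hsub, hset, Real.volume_Ico, ENNReal.toReal_ofReal, hIic]
  · ring
  · rw [hIic, ← sub_div, add_sub_cancel_left]
    exact div_nonneg (hw i) hW.le

theorem measurableSet_hits {α : Type*} [MeasurableSpace α] {w : α → Fin n → ℝ} {u : α → ℝ}
    (hw : ∀ i, Measurable fun a => w a i) (hu : Measurable u) (i : Fin n) :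
    MeasurableSet {a | Hits (w a) (u a) i} :=
  (measurableSet_le (Finset.measurable_sum _ fun k _ => hw k)
    (hu.mul (Finset.measurable_sum _ fun k _ => hw k))).inter
  (measurableSet_lt (hu.mul (Finset.measurable_sum _ fun k _ => hw k))
    (Finset.measurable_sum _ fun k _ => hw k))

end Sampling

/-! ### The truncated estimate of a coordinate -/

section Estimate

variable {f : ℝ → ℝ} {θ θ' θ'' ε₁ ε₂ : ℝ} {s n N : ℕ}

/-- The weights `f (v i) / e i`. -/
def expWeights (f : ℝ → ℝ) (e v : Fin n → ℝ) : Fin n → ℝ := fun i => (e i)⁻¹ * f (v i)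

/-- The value `v` over the expected number of times that `N` draws of a server with normalisation
`F` return its coordinate, where `e` is the exponential of the coordinate. -/
def sampleRatio (f : ℝ → ℝ) (N : ℕ) (F e v : ℝ) : ℝ := v / (N * (e⁻¹ * f v / F))

/-- The indicator of the event that the draw `t` of server `j` returns `i`. -/
def drawn (f : ℝ → ℝ) (x : Fin s → Fin n → ℝ) (e : Fin n → ℝ) (i : Fin n) (k : Fin s × Fin N)
    (ω : Fin s → Fin N → ℝ) : ℝ :=
  {u | Hits (expWeights f e (x k.1)) u i}.indicator 1 (ω k.1 k.2)

/-- The estimate of `∑ j, x j i` from the draws. -/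
def drawEstimate (f : ℝ → ℝ) (L : ℝ) (x : Fin s → Fin n → ℝ) (e : Fin n → ℝ)
    (ω : Fin s → Fin N → ℝ) (i : Fin n) : ℝ :=
  (winsorSum L fun k : Fin s × Fin N =>
    sampleRatio f N (∑ i', expWeights f e (x k.1) i') (e i) (x k.1 i) * drawn f x e i k ω) / 2

/-- The law of the servers' coins. -/
def coinsLaw (s N : ℕ) : Measure (Fin s → Fin N → ℝ) :=
  Measure.pi fun _ : Fin s => Measure.pi fun _ : Fin N => uniformCoin

instance : IsProbabilityMeasure (coinsLaw s N) := by unfold coinsLaw; infer_instance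

theorem ApproxInvertible.sum_le_map_sum (h : ApproxInvertible f θ θ' θ'' ε₁ ε₂) {ι : Type*}
    (T : Finset ι) {y : ι → ℝ} (hy : ∀ j, 0 ≤ y j) : ∑ j ∈ T, f (y j) ≤ f (∑ j ∈ T, y j) := by
  classical
  induction T using Finset.induction_on with
  | empty => simp [h.map_zero]
  | insert a T ha ih =>
    rw [Finset.sum_insert ha, Finset.sum_insert ha]
    exact (add_le_add le_rfl ih).trans
      (h.superadd _ _ (hy a) (Finset.sum_nonneg fun j _ => hy j))

theorem measurableSet_hits_point (w : Fin n → ℝ) (i : Fin n) :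
    MeasurableSet {u : ℝ | Hits w u i} :=
  measurableSet_hits (w := fun _ : ℝ => w) (u := id) (fun _ => measurable_const) measurable_id i

theorem drawn_eq_zero_or_one (x : Fin s → Fin n → ℝ) (e : Fin n → ℝ) (i : Fin n)
    (k : Fin s × Fin N) (ω : Fin s → Fin N → ℝ) : drawn f x e i k ω = 0 ∨ drawn f x e i k ω = 1 :=
  Set.indicator_eq_zero_or_self _ _ _

theorem measurable_drawn (x : Fin s → Fin n → ℝ) (e : Fin n → ℝ) (i : Fin n)
    (k : Fin s × Fin N) : Measurable (drawn f x e i k) :=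
  (measurable_one.indicator (measurableSet_hits_point _ i)).comp
    ((measurable_pi_apply k.2).comp (measurable_pi_apply k.1))

theorem iIndepFun_drawn (x : Fin s → Fin n → ℝ) (e : Fin n → ℝ) (i : Fin n) :
    iIndepFun (fun k : Fin s × Fin N => drawn f x e i k) (coinsLaw s N) := by
  have h := iIndepFun_uncurry_infinitePi' (fun (_ : Fin s) (_ : Fin N) => uniformCoin)
    (X := fun j _ => {u | Hits (expWeights f e (x j)) u i}.indicator (1 : ℝ → ℝ))
    fun j _ => measurable_one.indicator (measurableSet_hits_point _ i)
  simp only [Measure.infinitePi_eq_pi] at h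
  exact h

theorem expWeights_nonneg (h : ApproxInvertible f θ θ' θ'' ε₁ ε₂) {e v : Fin n → ℝ}
    (he : ∀ i, 0 < e i) (hv : ∀ i, 0 ≤ v i) (i : Fin n) : 0 ≤ expWeights f e v i :=
  mul_nonneg (inv_nonneg.2 (he i).le) (h.nonneg _ (hv i))

theorem integral_drawn (h : ApproxInvertible f θ θ' θ'' ε₁ ε₂) {x : Fin s → Fin n → ℝ}
    (hx : ∀ j i, 0 ≤ x j i) {e : Fin n → ℝ} (he : ∀ i, 0 < e i) (i : Fin n) (k : Fin s × Fin N) :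
    ∫ ω, drawn f x e i k ω ∂coinsLaw s N =
      (e i)⁻¹ * f (x k.1 i) / ∑ i', expWeights f e (x k.1) i' := by
  set g : ℝ → ℝ := {u | Hits (expWeights f e (x k.1)) u i}.indicator 1 with hg
  have hgm : Measurable g := measurable_one.indicator (measurableSet_hits_point _ i)
  have h1 : ∫ ω : Fin s → Fin N → ℝ, g (ω k.1 k.2) ∂coinsLaw s N =
      ∫ η : Fin N → ℝ, g (η k.2) ∂(Measure.pi fun _ : Fin N => uniformCoin) :=
    integral_comp_eval (μ := fun _ : Fin s => Measure.pi fun _ : Fin N => uniformCoin)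
      (i := k.1) (f := fun η => g (η k.2)) (hgm.comp (measurable_pi_apply _)).aestronglyMeasurable
  have h2 : ∫ η : Fin N → ℝ, g (η k.2) ∂(Measure.pi fun _ : Fin N => uniformCoin) =
      ∫ u, g u ∂uniformCoin :=
    integral_comp_eval (μ := fun _ : Fin N => uniformCoin) (i := k.2) hgm.aestronglyMeasurable
  change ∫ ω : Fin s → Fin N → ℝ, g (ω k.1 k.2) ∂coinsLaw s N = _
  rw [h1, h2, hg, integral_indicator_one (measurableSet_hits_point _ i),
    uniformCoin_real_hits (expWeights_nonneg h he (hx k.1))]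
  rfl

theorem inv_mul_le_sum_expWeights (h : ApproxInvertible f θ θ' θ'' ε₁ ε₂) {e v : Fin n → ℝ}
    (he : ∀ i, 0 < e i) (hv : ∀ i, 0 ≤ v i) (i : Fin n) :
    (e i)⁻¹ * f (v i) ≤ ∑ i', expWeights f e v i' :=
  Finset.single_le_sum (f := expWeights f e v) (fun i _ => expWeights_nonneg h he hv i)
    (Finset.mem_univ i)

theorem sampleRatio_nonneg (h : ApproxInvertible f θ θ' θ'' ε₁ ε₂) {e v : Fin n → ℝ}
    (he : ∀ i, 0 < e i) (hv : ∀ i, 0 ≤ v i) (i : Fin n) :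
    0 ≤ sampleRatio f N (∑ i', expWeights f e v i') (e i) (v i) :=
  div_nonneg (hv i) (mul_nonneg N.cast_nonneg (div_nonneg (expWeights_nonneg h he hv i)
    (Finset.sum_nonneg fun i _ => expWeights_nonneg h he hv i)))

/-- If `f` is not identically zero, every positive entry is drawn with positive probability. -/
theorem sampling_prob_pos (h : ApproxInvertible f θ θ' θ'' ε₁ ε₂) {z : ℝ} (hz : 0 ≤ z)
    (hfz : 0 < f z) {e v : Fin n → ℝ} (he : ∀ i, 0 < e i) (hv : ∀ i, 0 ≤ v i) {i : Fin n}
    (hi : 0 < v i) : 0 < (e i)⁻¹ * f (v i) / ∑ i', expWeights f e v i' := by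
  have h1 : 0 < (e i)⁻¹ * f (v i) := mul_pos (inv_pos.2 (he i)) (h.map_pos hz hfz hi)
  exact div_pos h1 (h1.trans_le (inv_mul_le_sum_expWeights h he hv i))

/-- This makes the untruncated sum unbiased: the `N` draws of a server contribute `v i` in
expectation. It needs `f` not identically zero, since otherwise a positive entry might never be
drawn. -/
theorem sampleRatio_mul_prob (h : ApproxInvertible f θ θ' θ'' ε₁ ε₂) {z : ℝ} (hz : 0 ≤ z)
    (hfz : 0 < f z) {e v : Fin n → ℝ} (he : ∀ i, 0 < e i) (hv : ∀ i, 0 ≤ v i) (hN : 0 < N)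
    (i : Fin n) :
    sampleRatio f N (∑ i', expWeights f e v i') (e i) (v i) *
      ((e i)⁻¹ * f (v i) / ∑ i', expWeights f e v i') = v i / N := by
  have hN' : (0 : ℝ) < N := by exact_mod_cast hN
  unfold sampleRatio
  rcases (hv i).eq_or_lt with h0 | h0
  · rw [← h0]; simp
  · have hq := sampling_prob_pos h hz hfz he hv h0
    set q := (e i)⁻¹ * f (v i) / ∑ i', expWeights f e v i'
    field_simp

theorem sum_prod_div_card (hN : 0 < N) (y : Fin s → ℝ) :
    ∑ k : Fin s × Fin N, y k.1 / N = ∑ j, y j := by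
  have hN' : (N : ℝ) ≠ 0 := by exact_mod_cast hN.ne'
  rw [Fintype.sum_prod_type]
  refine Finset.sum_congr rfl fun j _ => ?_
  dsimp only
  rw [Finset.sum_const, Finset.card_univ, Fintype.card_fin, nsmul_eq_mul]
  field_simp

/-- The halving in `drawEstimate` absorbs the factor two in `measure_winsorSum_gt`. -/
theorem measure_drawEstimate_gt (h : ApproxInvertible f θ θ' θ'' ε₁ ε₂) {z : ℝ} (hz : 0 ≤ z)
    (hfz : 0 < f z) {x : Fin s → Fin n → ℝ} (hx : ∀ j i, 0 ≤ x j i) {e : Fin n → ℝ}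
    (he : ∀ i, 0 < e i) (hN : 0 < N) {L : ℝ} (hL : 0 < L) (i : Fin n) :
    (coinsLaw s N).real {ω | ∑ j, x j i < drawEstimate f L x e ω i} ≤
      2 * Real.exp (-(L / 8)) := by
  have hmain := measure_winsorSum_gt (iIndepFun_drawn (f := f) (N := N) x e i)
    (measurable_drawn x e i) (drawn_eq_zero_or_one x e i)
    (r := fun k => sampleRatio f N (∑ i', expWeights f e (x k.1) i') (e i) (x k.1 i))
    (fun k => sampleRatio_nonneg h he (hx k.1) i) hL
  simp only [integral_drawn h hx he i, sampleRatio_mul_prob h hz hfz he (hx _) hN i,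
    sum_prod_div_card hN fun j => x j i] at hmain
  refine (measureReal_mono fun ω hω => ?_).trans hmain
  have hω' : ∑ j, x j i < drawEstimate f L x e ω i := hω
  unfold drawEstimate at hω'
  rw [lt_div_iff₀ two_pos, mul_comm] at hω'
  exact hω'

/-- At the maximal coordinate the estimate is rarely too small. -/
theorem measure_map_drawEstimate_lt (h : ApproxInvertible f θ θ' θ'' ε₁ ε₂) (hs : 1 ≤ s)
    {x : Fin s → Fin n → ℝ} (hx : ∀ j i, 0 ≤ x j i) {e : Fin n → ℝ} {D : ℝ} (hD : 0 ≤ D)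
    (he : e ∈ scaledSumGood D fun i => f (∑ j, x j i)) {i : Fin n}
    (hi : ∀ i', (e i')⁻¹ * f (∑ j, x j i') ≤ (e i)⁻¹ * f (∑ j, x j i))
    (hf : 0 < f (∑ j, x j i)) (hN : 0 < N) {L : ℝ} (hL : 0 < L)
    (hNL : 2 * L * (cf f s * D) ≤ N * (ε₁ * s)) :
    (coinsLaw s N).real {ω | f (drawEstimate f L x e ω i) <
      (1 - ε₂) / θ'' * f (∑ j, x j i)} ≤ 2 * Real.exp (-(L / 8)) := by
  have hz : 0 ≤ ∑ j, x j i := Finset.sum_nonneg fun j _ => hx j i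
  obtain ⟨hep, hsum⟩ := he
  have : Nonempty (Fin n) := ⟨i⟩
  have hs0 : (0 : ℝ) < s := by exact_mod_cast hs
  set y : Fin s → ℝ := fun j => x j i with hy
  set F : Fin s → ℝ := fun j => ∑ i', expWeights f e (x j) i' with hF
  set R : Fin s → ℝ := fun j => sampleRatio f N (F j) (e i) (y j) with hR
  have hy0 : ∀ j, 0 ≤ y j := fun j => hx j i
  have hR0 : ∀ j, 0 ≤ R j := fun j => sampleRatio_nonneg h hep (hx j) i
  have hRpos : ∀ j, 0 < y j → 0 < R j := fun j hj =>
    div_pos hj (mul_pos (by exact_mod_cast hN) (sampling_prob_pos h hz hf hep (hx j) hj))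
  obtain ⟨τ, hτ, hT, hS⟩ := h.exists_threshold hy0 hRpos hf
  -- Super-additivity bounds the local normalisations by the global weights, whose sum is at most
  -- `D` times the weight of the maximiser `i`.
  have hFsum : ∑ j, F j ≤ D * ((e i)⁻¹ * f (∑ j, y j)) := by
    calc ∑ j, F j = ∑ i', (e i')⁻¹ * ∑ j, f (x j i') := by
          simp only [hF, expWeights]
          rw [Finset.sum_comm]
          simp only [Finset.mul_sum]
      _ ≤ ∑ i', (e i')⁻¹ * f (∑ j, x j i') := by
          gcongr with i'
          · exact inv_nonneg.2 (hep i').le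
          · exact h.sum_le_map_sum _ fun j => hx j i'
      _ ≤ _ := hsum.trans (mul_le_mul_of_nonneg_left (ciSup_le hi) hD)
  have hq := h.le_sum_sampling_prob hs hy0 (hep i)
    (fun j => inv_mul_le_sum_expWeights h hep (hx j) i) hFsum hf hT
  have hcf : 0 < cf f s := hs0.trans_le (h.le_cf hz hf hs)
  set q : Fin s → ℝ := fun j => (e i)⁻¹ * f (y j) / F j with hqdef
  have hqR : ∀ j, R j * q j = y j / N := fun j => sampleRatio_mul_prob h hz hf hep (hx j) hN i
  have hq0 : ∀ j, 0 ≤ q j := fun j => div_nonneg (expWeights_nonneg h hep (hx j) i)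
    (Finset.sum_nonneg fun i _ => expWeights_nonneg h hep (hx j) i)
  -- This is what `N` is chosen for: the servers at or above `τ` produce at least `2 * L` draws of
  -- `i` in expectation.
  have hP : 2 * L ≤ ∑ k : Fin s × Fin N, if τ ≤ R k.1 then q k.1 else 0 := by
    have hcount : ∑ k : Fin s × Fin N, (if τ ≤ R k.1 then q k.1 else 0) =
        N * ∑ j with τ ≤ R j, q j := by
      rw [Fintype.sum_prod_type, Finset.sum_filter, Finset.mul_sum]
      simp
    rw [hcount]
    have hD' : 0 < cf f s * D := by
      refine lt_of_le_of_ne (mul_nonneg hcf.le hD) fun h0 => ?_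
      rw [← h0, zero_mul] at hq
      nlinarith [mul_pos h.eps₁_pos hs0]
    have h1 : (N : ℝ) * (ε₁ * s) ≤ N * (cf f s * D * ∑ j with τ ≤ R j, q j) :=
      mul_le_mul_of_nonneg_left hq N.cast_nonneg
    refine le_of_mul_le_mul_right ?_ hD'
    linarith
  have hmain := measure_winsorSum_lt (iIndepFun_drawn (f := f) (N := N) x e i)
    (measurable_drawn x e i) (drawn_eq_zero_or_one x e i)
    (r := fun k => R k.1) (fun k => hR0 k.1) hL hτ (by
      simp only [integral_drawn h hx hep i]
      exact hP)
  simp only [integral_drawn h hx hep i] at hmain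
  refine (measureReal_mono fun ω hω => ?_).trans hmain
  by_contra hc
  simp only [Set.mem_ofPred_eq, not_lt] at hc
  -- Servers with ratio at most `τ` are unaffected by the cut, so their entries are counted in full.
  have hmin : ∑ j with R j ≤ τ, y j ≤ ∑ k : Fin s × Fin N, min (R k.1) τ * q k.1 := by
    rw [Finset.sum_filter, ← sum_prod_div_card hN]
    refine Finset.sum_le_sum fun k _ => ?_
    split_ifs with hk
    · rw [min_eq_left hk, hqR]
    · rw [zero_div]
      exact mul_nonneg (le_min (hR0 _) hτ.le) (hq0 _)
  have hxS : 0 ≤ ∑ j with R j ≤ τ, y j := Finset.sum_nonneg fun j _ => hy0 j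
  -- One factor two comes from the lower tail and one from the halving; their product `4` is covered
  -- by the scale in `scale_down`.
  have hest : (∑ j with R j ≤ τ, y j) / (4 * √θ * θ') ≤ drawEstimate f L x e ω i := by
    calc _ ≤ (∑ j with R j ≤ τ, y j) / 4 :=
          div_le_div_of_nonneg_left hxS (by norm_num) h.four_lt_scale.le
      _ ≤ (∑ k : Fin s × Fin N, min (R k.1) τ * q k.1) / 2 / 2 := by linarith
      _ ≤ _ := div_le_div_of_nonneg_right hc zero_le_two
  have hθ : 0 < θ'' := by linarith [h.one_lt_theta'']
  have hρ := h.four_lt_scale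
  refine absurd (show f (drawEstimate f L x e ω i) < _ from hω) (not_lt.2 ?_)
  calc (1 - ε₂) / θ'' * f (∑ j, x j i) = (1 - ε₂) * f (∑ j, y j) / θ'' := by ring
    _ ≤ f (∑ j with R j ≤ τ, y j) / θ'' := by gcongr
    _ ≤ _ := h.scale_down _ hxS
    _ ≤ _ := h.mono (div_nonneg hxS (by linarith)) hest

theorem measurable_drawEstimate (L : ℝ) (x : Fin s → Fin n → ℝ) (i : Fin n) :
    Measurable fun p : (Fin n → ℝ) × (Fin s → Fin N → ℝ) => drawEstimate f L x p.1 p.2 i := by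
  have hw : ∀ j i', Measurable fun p : (Fin n → ℝ) × (Fin s → Fin N → ℝ) =>
      expWeights f p.1 (x j) i' := fun j i' => by
    unfold expWeights; fun_prop
  refine (measurable_winsorSum L fun k => Measurable.mul ?_ ?_).div_const 2
  · unfold sampleRatio
    have := Finset.measurable_sum Finset.univ fun i' _ => hw k.1 i'
    fun_prop
  · exact Measurable.ite (measurableSet_hits (hw k.1) (by fun_prop) i) measurable_const
      measurable_const

theorem drawEstimate_nonneg (h : ApproxInvertible f θ θ' θ'' ε₁ ε₂) {L : ℝ}
    {x : Fin s → Fin n → ℝ} (hx : ∀ j i, 0 ≤ x j i) {e : Fin n → ℝ} (he : ∀ i, 0 < e i)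
    (ω : Fin s → Fin N → ℝ) (i : Fin n) : 0 ≤ drawEstimate f L x e ω i := by
  refine div_nonneg (winsorSum_nonneg fun k => mul_nonneg (sampleRatio_nonneg h he (hx k.1) i) ?_)
    zero_le_two
  rcases drawn_eq_zero_or_one (f := f) x e i k ω with h | h <;> simp [h]

end Estimate

/-! ### The messages of the protocol and their length -/

section Protocol

variable {f : ℝ → ℝ} {θ θ' θ'' ε₁ ε₂ : ℝ} {s n N : ℕ}

/-- The words that describe the outcome of one draw. -/
def drawWords (F : ℝ) (v : Fin n → ℝ) : Option (Fin n) → List (Word n)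
  | some i => [Word.index i, Word.number (v i)]
  | none => [Word.number F]

/-- The normalisation, followed by the outcomes of the draws. -/
def reportWords (F : ℝ) (v : Fin n → ℝ) (draws : List (Option (Fin n))) : List (Word n) :=
  Word.number F :: (draws.map (drawWords F v)).flatten

/-- Recovers the outcomes of the draws from the words that describe them. -/
def readDraws : List (Word n) → List (Option (Fin n × ℝ))
  | Word.index i :: Word.number r :: l => some (i, r) :: readDraws l
  | Word.number _ :: l => none :: readDraws l
  | _ => []

/-- The real number in a word, `0` if there is none. -/
def Word.value : Word n → ℝ
  | Word.number r => r
  | Word.index _ => 0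

/-- The encoding is uniquely decodable: a successful draw starts with an index, a failed one with a
number. -/
theorem readDraws_flatten (F : ℝ) (v : Fin n → ℝ) (draws : List (Option (Fin n))) :
    readDraws (draws.map (drawWords F v)).flatten =
      draws.map (Option.map fun i => (i, v i)) := by
  induction draws with
  | nil => simp [readDraws]
  | cons o l ih => cases o <;> simp [drawWords, readDraws, ih]

theorem length_reportWords_le (F : ℝ) (v : Fin n → ℝ) (draws : List (Option (Fin n))) :
    (reportWords F v draws).length ≤ 1 + 2 * draws.length := by
  unfold reportWords
  induction draws with
  | nil => simp
  | cons o l ih => cases o <;> simp_all [drawWords] <;> omega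

theorem number_mem_reportWords {F r : ℝ} {v : Fin n → ℝ} {draws : List (Option (Fin n))}
    (h : Word.number r ∈ reportWords F v draws) : r = F ∨ ∃ i, r = v i := by
  rcases List.mem_cons.1 h with h | h
  · exact Or.inl (Word.number.inj h)
  · obtain ⟨l, hl, hr⟩ := List.mem_flatten.1 h
    obtain ⟨o, -, rfl⟩ := List.mem_map.1 hl
    cases o with
    | none => exact Or.inl (by simpa [drawWords] using hr)
    | some i => exact Or.inr ⟨i, by simpa [drawWords] using hr⟩

/-- The report of a server with vector `v` and coin `u`. -/
def serverReport (f : ℝ → ℝ) (v e : Fin n → ℝ) (u : Fin N → ℝ) : List (Word n) :=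
  reportWords (∑ i, expWeights f e v i) v (List.ofFn fun t => pick (expWeights f e v) (u t))

/-- The ratio that the coordinator assigns to the draw `t` of a server with report `m`, if this
draw returned `i`. -/
def reportRatio (f : ℝ → ℝ) (N : ℕ) (e : Fin n → ℝ) (m : List (Word n)) (t : Fin N)
    (i : Fin n) : ℝ :=
  match (readDraws m.tail).getD t none with
  | some (i', v) => if i' = i then sampleRatio f N (m.map Word.value).headI (e i) v else 0
  | none => 0

/-- The coordinator's estimate of the coordinate `i`. -/
def reportEstimate (f : ℝ → ℝ) (N : ℕ) (L : ℝ) (e : Fin n → ℝ) (m : Fin s → List (Word n))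
    (i : Fin n) : ℝ :=
  (winsorSum L fun k : Fin s × Fin N => reportRatio f N e (m k.1) k.2 i) / 2

open Classical in
/-- The coordinates that have at most `Q` scores at or above their own. -/
def topScores (Q : ℝ) (score : Fin n → ℝ) : Finset (Fin n) :=
  {i | ((Finset.univ.filter fun i' => score i ≤ score i').card : ℝ) ≤ Q}

/-- All members score at least as high as the lowest-scoring member, which has at most `Q` such
competitors. Ties therefore cannot inflate the set. -/
theorem card_topScores_le {Q : ℝ} (hQ : 0 ≤ Q) (score : Fin n → ℝ) :
    ((topScores Q score).card : ℝ) ≤ Q := by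
  classical
  rcases (topScores Q score).eq_empty_or_nonempty with h | h
  · rw [h]; simpa using hQ
  · obtain ⟨i, hi, hmin⟩ := Finset.exists_min_image _ score h
    refine le_trans ?_ (Finset.mem_filter.1 hi).2
    exact_mod_cast Finset.card_le_card fun i' hi' => by simpa using hmin i' hi'

/-- The coordinates for which the coordinator asks. -/
def candidates (f : ℝ → ℝ) (N : ℕ) (L Q : ℝ) (e : Fin n → ℝ) (m : Fin s → List (Word n)) :
    Finset (Fin n) :=
  topScores Q fun i => (e i)⁻¹ * f (reportEstimate f N L e m i)

open Classical in
/-- Every server reports its normalisation and `N` draws with probabilities proportional to its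
weights; the coordinator asks for the coordinates with the highest scores and returns the maximum
over them. -/
def samplingProtocol (f : ℝ → ℝ) (s n N : ℕ) (L Q : ℝ) : TwoRoundProtocol s n where
  Coin := Fin N → ℝ
  coinLaw := Measure.pi fun _ => uniformCoin
  report _ v e u := serverReport f v e u
  query e m _ := (candidates f N L Q e m).toList.map Word.index
  answer _ v _ _ q := q.filterMap fun w =>
    match w with
    | Word.index i => some (Word.number (v i))
    | Word.number _ => none
  output e m a := ⨆ i, if i ∈ candidates f N L Q e m then
    (e i)⁻¹ * f (∑ j, ((a j).getD ((candidates f N L Q e m).toList.idxOf i)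
      (Word.number 0)).value) else 0

theorem samplingProtocol_answers (L Q : ℝ) (x : Fin s → Fin n → ℝ) (e : Fin n → ℝ)
    (ω : Fin s → Fin N → ℝ) (j : Fin s) :
    (samplingProtocol f s n N L Q).answers x e ω j =
      (candidates f N L Q e fun j => serverReport f (x j) e (ω j)).toList.map
        fun i => Word.number (x j i) := by
  change (List.map Word.index _).filterMap _ = _
  rw [List.filterMap_map]
  exact congrFun List.filterMap_eq_map' _

open Classical in
-- The answers carry no indices. They follow the order of `toList`, and the coordinator recovers
-- that list from the reports to locate each entry.
theorem samplingProtocol_result (L Q : ℝ) (x : Fin s → Fin n → ℝ) (e : Fin n → ℝ)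
    (ω : Fin s → Fin N → ℝ) :
    (samplingProtocol f s n N L Q).result x e ω =
      ⨆ i, if i ∈ candidates f N L Q e (fun j => serverReport f (x j) e (ω j)) then
        (e i)⁻¹ * f (∑ j, x j i) else 0 := by
  unfold TwoRoundProtocol.result
  change (⨆ i, if i ∈ candidates f N L Q e (fun j => serverReport f (x j) e (ω j)) then
    (e i)⁻¹ * f (∑ j, (((samplingProtocol f s n N L Q).answers x e ω j).getD
      ((candidates f N L Q e (fun j => serverReport f (x j) e (ω j))).toList.idxOf i)
      (Word.number 0)).value) else 0) = _
  congr 1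
  ext i
  split_ifs with hi
  · congr 3
    ext j
    rw [samplingProtocol_answers]
    have hlt := List.idxOf_lt_length_iff.2 (Finset.mem_toList.2 hi)
    rw [List.getD_eq_getElem _ _ (by simpa using hlt), List.getElem_map, List.getElem_idxOf]
    rfl
  · rfl

theorem samplingProtocol_numbersAreHeld (L Q : ℝ) (x : Fin s → Fin n → ℝ) (e : Fin n → ℝ)
    (ω : Fin s → Fin N → ℝ) :
    (samplingProtocol f s n N L Q).NumbersAreHeld f x e ω := by
  refine ⟨fun j r hr => ?_, fun j r hr => ?_, fun j r hr => Or.inl ?_⟩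
  · rcases number_mem_reportWords hr with h | h
    · exact Or.inr h
    · exact Or.inl h
  · obtain ⟨i, -, h⟩ := List.mem_map.1 (show Word.number r ∈ List.map Word.index _ from hr)
    cases h
  · have hr' : Word.number r ∈ (samplingProtocol f s n N L Q).answers x e ω j := hr
    rw [samplingProtocol_answers] at hr'
    obtain ⟨i, -, h⟩ := List.mem_map.1 hr'
    exact Or.inl ⟨i, (Word.number.inj h).symm⟩

theorem samplingProtocol_communication_le {L Q : ℝ} (hQ : 0 ≤ Q) (x : Fin s → Fin n → ℝ)
    (e : Fin n → ℝ) (ω : Fin s → Fin N → ℝ) :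
    ((samplingProtocol f s n N L Q).communication x e ω : ℝ) ≤ s * (1 + 2 * N + 2 * Q) := by
  have hC := card_topScores_le hQ fun i => (e i)⁻¹ *
    f (reportEstimate f N L e (fun j => serverReport f (x j) e (ω j)) i)
  unfold TwoRoundProtocol.communication
  push_cast
  calc _ ≤ ∑ _j : Fin s, (1 + 2 * N + 2 * Q : ℝ) := by
        refine Finset.sum_le_sum fun j _ => ?_
        have h1 : (((samplingProtocol f s n N L Q).reports x e ω j).length : ℝ) ≤ 1 + 2 * N := by
          have := length_reportWords_le (∑ i, expWeights f e (x j) i) (x j)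
            (List.ofFn fun t => pick (expWeights f e (x j)) (ω j t))
          rw [List.length_ofFn] at this
          exact_mod_cast this
        have h2 : (((samplingProtocol f s n N L Q).queries x e ω j).length : ℝ) ≤ Q := by
          change ((List.map Word.index _).length : ℝ) ≤ Q
          rw [List.length_map, Finset.length_toList]
          exact hC
        have h3 : (((samplingProtocol f s n N L Q).answers x e ω j).length : ℝ) ≤ Q := by
          rw [samplingProtocol_answers, List.length_map, Finset.length_toList]
          exact hC
        linarith
    _ = _ := by
        rw [Finset.sum_const, Finset.card_univ, Fintype.card_fin, nsmul_eq_mul]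

/-- Connects what the coordinator computes from words with the random variable analysed above; the
index drawn by `pick` is `i` exactly when `Hits` holds for `i`. -/
theorem reportEstimate_eq_drawEstimate (h : ApproxInvertible f θ θ' θ'' ε₁ ε₂) (L : ℝ)
    {x : Fin s → Fin n → ℝ} (hx : ∀ j i, 0 ≤ x j i) {e : Fin n → ℝ} (he : ∀ i, 0 < e i)
    (ω : Fin s → Fin N → ℝ) (i : Fin n) :
    reportEstimate f N L e (fun j => serverReport f (x j) e (ω j)) i =
      drawEstimate f L x e ω i := by
  classical
  unfold reportEstimate drawEstimate
  congr 2
  ext ⟨j, t⟩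
  have hw := expWeights_nonneg h he (hx j)
  have hread : (readDraws (serverReport f (x j) e (ω j)).tail).getD t none =
      (pick (expWeights f e (x j)) (ω j t)).map fun i => (i, x j i) := by
    rw [serverReport, reportWords, List.tail_cons, readDraws_flatten,
      List.getD_eq_getElem _ _ (by simp), List.getElem_map, List.getElem_ofFn]
  have hhead : ((serverReport f (x j) e (ω j)).map Word.value).headI =
      ∑ i', expWeights f e (x j) i' := rfl
  simp only [reportRatio, hread, hhead, drawn, Set.indicator_apply, Set.mem_ofPred_eq,
    ← pick_eq_some_iff hw]
  obtain hp | ⟨i', hp⟩ := (pick (expWeights f e (x j)) (ω j t)).eq_none_or_eq_some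
  · simp [hp]
  · by_cases hi : i' = i
    · subst hi; simp [hp]
    · simp [hp, hi]

/-- The protocol that sends nothing. -/
def silentProtocol (s n : ℕ) : TwoRoundProtocol s n where
  Coin := Unit
  coinLaw := Measure.dirac ()
  report _ _ _ _ := []
  query _ _ _ := []
  answer _ _ _ _ _ := []
  output _ _ _ := 0

end Protocol

/-! ### Error probability -/

section Correctness

variable {f : ℝ → ℝ} {θ θ' θ'' ε₁ ε₂ : ℝ} {s n N : ℕ}

/-- The coins are independent of the exponentials, so it suffices to bound the failure probability
for each fixed `e`. -/
theorem prod_measureReal_le_of_forall {α β : Type*} [MeasurableSpace α] [MeasurableSpace β]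
    {μ : Measure α} {ν : Measure β} [IsProbabilityMeasure μ] [IsProbabilityMeasure ν]
    {B : Set (α × β)} (hB : MeasurableSet B) {δ : ℝ} (hδ : 0 ≤ δ)
    (h : ∀ a, ν.real {b | (a, b) ∈ B} ≤ δ) : (μ.prod ν).real B ≤ δ := by
  refine ENNReal.toReal_le_of_le_ofReal hδ ?_
  rw [Measure.prod_apply hB]
  calc ∫⁻ a, ν (Prod.mk a ⁻¹' B) ∂μ ≤ ∫⁻ _a, ENNReal.ofReal δ ∂μ := lintegral_mono fun a =>
        (ENNReal.le_ofReal_iff_toReal_le (measure_ne_top _ _) hδ).2 (h a)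
    _ = ENNReal.ofReal δ := by simp

/-- The estimate of `i` is too large. -/
def overEstimated (f : ℝ → ℝ) (N : ℕ) (L : ℝ) (x : Fin s → Fin n → ℝ) (i : Fin n) :
    Set ((Fin n → ℝ) × (Fin s → Fin N → ℝ)) :=
  {p | (∀ i', 0 < p.1 i') ∧ ∑ j, x j i < drawEstimate f L x p.1 p.2 i}

/-- The coordinate `i` is maximal and its estimate is too small. -/
def underEstimated (f : ℝ → ℝ) (N : ℕ) (L D δ : ℝ) (x : Fin s → Fin n → ℝ) (i : Fin n) :
    Set ((Fin n → ℝ) × (Fin s → Fin N → ℝ)) :=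
  {p | (p.1 ∈ scaledSumGood D (fun i => f (∑ j, x j i)) ∧
    ∀ i', (p.1 i')⁻¹ * f (∑ j, x j i') ≤ (p.1 i)⁻¹ * f (∑ j, x j i)) ∧
    f (max 0 (drawEstimate f L x p.1 p.2 i)) < δ * f (∑ j, x j i)}

theorem measurableSet_overEstimated (L : ℝ) (x : Fin s → Fin n → ℝ) (i : Fin n) :
    MeasurableSet (overEstimated f N L x i) := by
  refine MeasurableSet.inter
    (s₁ := {p : (Fin n → ℝ) × (Fin s → Fin N → ℝ) | ∀ i', 0 < p.1 i'}) ?_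
    (measurableSet_lt measurable_const (measurable_drawEstimate L x i))
  rw [Set.ofPred_forall]
  exact MeasurableSet.iInter fun i' => measurableSet_lt measurable_const (by fun_prop)

/-- Nothing is known about `f` on negative numbers. Composing with `max 0` gives a monotone, hence
measurable, function, and the estimates are nonnegative on the good event anyway. -/
theorem measurableSet_underEstimated (h : ApproxInvertible f θ θ' θ'' ε₁ ε₂) (L D δ : ℝ)
    (x : Fin s → Fin n → ℝ) (i : Fin n) : MeasurableSet (underEstimated f N L D δ x i) := by
  have hmono : Monotone fun y => f (max 0 y) := fun a b hab =>
    h.mono (le_max_left _ _) (max_le_max le_rfl hab)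
  refine MeasurableSet.inter (MeasurableSet.inter
    (s₁ := {p : (Fin n → ℝ) × (Fin s → Fin N → ℝ) |
      p.1 ∈ scaledSumGood D (fun i => f (∑ j, x j i))})
    (s₂ := {p : (Fin n → ℝ) × (Fin s → Fin N → ℝ) |
      ∀ i', (p.1 i')⁻¹ * f (∑ j, x j i') ≤ (p.1 i)⁻¹ * f (∑ j, x j i)})
    (measurable_fst (measurableSet_scaledSumGood D _)) ?_)
    (measurableSet_lt (hmono.measurable.comp (measurable_drawEstimate L x i)) measurable_const)
  rw [Set.ofPred_forall]
  exact MeasurableSet.iInter fun i' => measurableSet_le (by fun_prop) (by fun_prop)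

theorem candidates_correct (h : ApproxInvertible f θ θ' θ'' ε₁ ε₂) {x : Fin s → Fin n → ℝ}
    (hx : ∀ j i, 0 ≤ x j i) (hpos : 0 < ∑ i, f (∑ j, x j i)) {L D : ℝ}
    {p : (Fin n → ℝ) × (Fin s → Fin N → ℝ)}
    (hG : p.1 ∈ scaledSumGood D fun i => f (∑ j, x j i))
    (hover : ∀ i, p ∉ overEstimated f N L x i)
    (hunder : ∀ i, p ∉ underEstimated f N L D ((1 - ε₂) / θ'') x i) :
    (samplingProtocol f s n N L (D * θ'' / (1 - ε₂))).result x p.1 p.2 =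
      ⨆ i, (p.1 i)⁻¹ * f (∑ j, x j i) := by
  classical
  obtain ⟨e, ω⟩ := p
  obtain ⟨he, hsum⟩ := hG
  have hθ : 0 < θ'' := by linarith [h.one_lt_theta'']
  have hε : 0 < 1 - ε₂ := by linarith [h.eps₂_lt_one]
  have ha : ∀ i, 0 ≤ f (∑ j, x j i) := fun i => h.nonneg _ (Finset.sum_nonneg fun j _ => hx j i)
  have hb : ∀ i, 0 ≤ (e i)⁻¹ * f (∑ j, x j i) := fun i =>
    mul_nonneg (inv_nonneg.2 (he i).le) (ha i)
  have hne : Nonempty (Fin n) := by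
    by_contra hn
    rw [not_nonempty_iff] at hn
    simp at hpos
  obtain ⟨i₀, hi₀⟩ := Finite.exists_max fun i => (e i)⁻¹ * f (∑ j, x j i)
  have hmax : ⨆ i, (e i)⁻¹ * f (∑ j, x j i) = (e i₀)⁻¹ * f (∑ j, x j i₀) :=
    le_antisymm (ciSup_le hi₀)
      (le_ciSup (f := fun i => (e i)⁻¹ * f (∑ j, x j i)) (Set.finite_range _).bddAbove i₀)
  set M := (e i₀)⁻¹ * f (∑ j, x j i₀) with hM
  have hMpos : 0 < M := by
    refine (hb i₀).lt_of_ne fun h0 => hpos.ne' (Finset.sum_eq_zero fun i _ => ?_)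
    have h1 : (e i)⁻¹ * f (∑ j, x j i) = 0 := le_antisymm ((hi₀ i).trans h0.symm.le) (hb i)
    exact (mul_eq_zero.1 h1).resolve_left (inv_ne_zero (he i).ne')
  have hover' : ∀ i, drawEstimate f L x e ω i ≤ ∑ j, x j i := fun i => by
    by_contra hc
    exact hover i ⟨he, not_le.1 hc⟩
  have hunder' : (1 - ε₂) / θ'' * f (∑ j, x j i₀) ≤ f (drawEstimate f L x e ω i₀) := by
    by_contra hc
    refine hunder i₀ ⟨⟨⟨he, hsum⟩, hi₀⟩, ?_⟩
    rw [max_eq_right (drawEstimate_nonneg h hx he ω i₀)]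
    exact not_le.1 hc
  have hmem : i₀ ∈ candidates f N L (D * θ'' / (1 - ε₂)) e
      (fun j => serverReport f (x j) e (ω j)) := by
    simp only [candidates, topScores, reportEstimate_eq_drawEstimate h L hx he,
      Finset.mem_filter, Finset.mem_univ, true_and]
    rw [le_div_iff₀ hε]
    set S : Finset (Fin n) := Finset.univ.filter fun i' =>
      (e i₀)⁻¹ * f (drawEstimate f L x e ω i₀) ≤ (e i')⁻¹ * f (drawEstimate f L x e ω i')
    -- A score at least that of the maximiser, together with the absence of overestimates, forces a
    -- large true weight.
    have hS : ∀ i ∈ S, (1 - ε₂) / θ'' * M ≤ (e i)⁻¹ * f (∑ j, x j i) := by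
      intro i hi
      calc (1 - ε₂) / θ'' * M = (e i₀)⁻¹ * ((1 - ε₂) / θ'' * f (∑ j, x j i₀)) := by
            rw [hM]; ring
        _ ≤ (e i₀)⁻¹ * f (drawEstimate f L x e ω i₀) :=
            mul_le_mul_of_nonneg_left hunder' (inv_nonneg.2 (he i₀).le)
        _ ≤ (e i)⁻¹ * f (drawEstimate f L x e ω i) := (Finset.mem_filter.1 hi).2
        _ ≤ _ := mul_le_mul_of_nonneg_left
            (h.mono (drawEstimate_nonneg h hx he ω i) (hover' i)) (inv_nonneg.2 (he i).le)
    -- Total weight at most `D * M` leaves room for at most `D * θ'' / (1 - ε₂)` coordinates of this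
    -- weight.
    have hcount : S.card * ((1 - ε₂) / θ'' * M) ≤ D * M := by
      calc S.card * ((1 - ε₂) / θ'' * M) ≤ ∑ i ∈ S, (e i)⁻¹ * f (∑ j, x j i) := by
            rw [← nsmul_eq_mul]
            exact Finset.card_nsmul_le_sum _ _ _ hS
        _ ≤ ∑ i, (e i)⁻¹ * f (∑ j, x j i) :=
            Finset.sum_le_sum_of_subset_of_nonneg (Finset.subset_univ _) fun i _ _ => hb i
        _ ≤ D * M := hmax ▸ hsum
    rw [← mul_assoc] at hcount
    have h2 := le_of_mul_le_mul_right hcount hMpos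
    rw [mul_div_assoc', div_le_iff₀ hθ] at h2
    exact h2
  rw [samplingProtocol_result, hmax]
  refine le_antisymm (ciSup_le fun i => ?_) ?_
  · split_ifs
    · exact hi₀ i
    · exact hMpos.le
  · refine le_trans ?_ (le_ciSup (Set.finite_range _).bddAbove i₀)
    rw [if_pos hmem]

/-- The sampling protocol rarely errs. -/
theorem samplingProtocol_law_le (h : ApproxInvertible f θ θ' θ'' ε₁ ε₂) (hs : 1 ≤ s)
    (hn : 2 ≤ n) {x : Fin s → Fin n → ℝ} (hx : ∀ j i, 0 ≤ x j i) {T D L : ℝ} (hT : 0 < T)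
    (hD : D = (T + 2) * (T + 16) * Real.log n ^ 2) (hL : L = 8 * T * Real.log n)
    (hNL : 2 * L * (cf f s * D) ≤ N * (ε₁ * s)) :
    (samplingProtocol f s n N L (D * θ'' / (1 - ε₂))).law
      {r | (samplingProtocol f s n N L (D * θ'' / (1 - ε₂))).result x r.1 r.2 ≠
        ⨆ i : Fin n, (r.1 i)⁻¹ * f (∑ j, x j i)} ≤
      ENNReal.ofReal ((2 + 4 * n) * Real.exp (-(T * Real.log n))) := by
  have hlog := one_le_two_mul_log hn
  have hlog0 : 0 < Real.log n := by linarith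
  have hL0 : 0 < L := by rw [hL]; positivity
  have hD0 : 0 < D := by rw [hD]; positivity
  have hx0 : ∀ i, 0 ≤ ∑ j, x j i := fun i => Finset.sum_nonneg fun j _ => hx j i
  have ha : ∀ i, 0 ≤ f (∑ j, x j i) := fun i => h.nonneg _ (hx0 i)
  set P := samplingProtocol f s n N L (D * θ'' / (1 - ε₂)) with hP
  -- If all weights vanish, every possible output is `0` and the protocol never errs.
  rcases (Finset.sum_nonneg fun i _ => ha i : 0 ≤ ∑ i, f (∑ j, x j i)).eq_or_lt with h0 | hpos
  · have hz : ∀ i, f (∑ j, x j i) = 0 := fun i =>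
      (Finset.sum_eq_zero_iff_of_nonneg fun i _ => ha i).1 h0.symm i (Finset.mem_univ i)
    have hempty : {r : (Fin n → ℝ) × (Fin s → P.Coin) | P.result x r.1 r.2 ≠
        ⨆ i : Fin n, (r.1 i)⁻¹ * f (∑ j, x j i)} = ∅ := by
      refine Set.eq_empty_of_forall_notMem fun r hr => hr ?_
      refine (samplingProtocol_result _ _ x r.1 r.2).trans ?_
      simp [hz]
    rw [hempty, measure_empty]
    exact zero_le
  obtain ⟨z, hz⟩ : ∃ i, 0 < f (∑ j, x j i) := by
    by_contra hc
    push Not at hc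
    exact absurd (Finset.sum_nonpos fun i _ => hc i) (not_le.2 hpos)
  have hs0 : (0 : ℝ) < s := by exact_mod_cast hs
  have hcf : 0 < cf f s := hs0.trans_le (h.le_cf (hx0 z) hz hs)
  have hN : 0 < N := by
    rcases N.eq_zero_or_pos with h1 | h1
    · rw [h1, Nat.cast_zero, zero_mul] at hNL
      exact absurd hNL (not_le.2 (by positivity))
    · exact h1
  set ν := Measure.pi fun _ : Fin n => expMeasure 1 with hν
  set η := Real.exp (-(T * Real.log n)) with hη
  have hLη : Real.exp (-(L / 8)) = η := by rw [hη, hL]; congr 1; ring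
  set G := scaledSumGood D fun i => f (∑ j, x j i) with hG
  have hGc : (ν.prod (coinsLaw s N)).real (Gᶜ ×ˢ Set.univ) ≤ 2 * η := by
    rw [measureReal_prod_prod, probReal_univ, mul_one, hG, hD]
    exact measure_compl_scaledSumGood hn ha hpos hT
  have hO : ∀ i, (ν.prod (coinsLaw s N)).real (overEstimated f N L x i) ≤ 2 * η := fun i => by
    refine prod_measureReal_le_of_forall (measurableSet_overEstimated L x i) (by positivity)
      fun e => ?_
    by_cases he : ∀ i', 0 < e i'
    · rw [← hLη]
      exact (measureReal_mono fun ω hω => hω.2).trans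
        (measure_drawEstimate_gt h (hx0 z) hz hx he hN hL0 i)
    · have : {ω | (e, ω) ∈ overEstimated f N L x i} = ∅ :=
        Set.eq_empty_of_forall_notMem fun ω hω => he hω.1
      rw [this, measureReal_empty]
      positivity
  have hU : ∀ i, (ν.prod (coinsLaw s N)).real
      (underEstimated f N L D ((1 - ε₂) / θ'') x i) ≤ 2 * η := fun i => by
    refine prod_measureReal_le_of_forall (measurableSet_underEstimated h L D _ x i)
      (by positivity) fun e => ?_
    by_cases he : e ∈ G ∧ ∀ i', (e i')⁻¹ * f (∑ j, x j i') ≤ (e i)⁻¹ * f (∑ j, x j i)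
    · have hfi : 0 < f (∑ j, x j i) := by
        refine (ha i).lt_of_ne fun h0 => ?_
        have h1 := he.2 z
        rw [← h0, mul_zero] at h1
        exact absurd h1 (not_le.2 (mul_pos (inv_pos.2 (he.1.1 z)) hz))
      rw [← hLη]
      refine (measureReal_mono fun ω hω => ?_).trans
        (measure_map_drawEstimate_lt h hs hx hD0.le he.1 he.2 hfi hN hL0 hNL)
      have h2 := hω.2
      rw [max_eq_right (drawEstimate_nonneg h hx he.1.1 ω i)] at h2
      exact h2
    · have : {ω | (e, ω) ∈ underEstimated f N L D ((1 - ε₂) / θ'') x i} = ∅ :=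
        Set.eq_empty_of_forall_notMem fun ω hω => he hω.1
      rw [this, measureReal_empty]
      positivity
  -- The maximiser depends on `e`, so the union runs over all coordinates: `1 + 2 * n` bad events of
  -- probability at most `2 * η`.
  have hbad : {r : (Fin n → ℝ) × (Fin s → Fin N → ℝ) | P.result x r.1 r.2 ≠
      ⨆ i : Fin n, (r.1 i)⁻¹ * f (∑ j, x j i)} ⊆ Gᶜ ×ˢ Set.univ ∪
        ((⋃ i, overEstimated f N L x i) ∪
          ⋃ i, underEstimated f N L D ((1 - ε₂) / θ'') x i) := by
    intro r hr
    by_contra hc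
    simp only [Set.mem_union, Set.mem_iUnion, Set.mem_prod, Set.mem_compl_iff, Set.mem_univ,
      and_true, not_or, not_not, not_exists] at hc
    exact hr (candidates_correct h hx hpos hc.1 hc.2.1 hc.2.2)
  have hfin : (ν.prod (coinsLaw s N)).real {r : (Fin n → ℝ) × (Fin s → Fin N → ℝ) |
      P.result x r.1 r.2 ≠ ⨆ i : Fin n, (r.1 i)⁻¹ * f (∑ j, x j i)} ≤ (2 + 4 * n) * η := by
    refine (measureReal_mono hbad).trans ((measureReal_union_le _ _).trans
      ((add_le_add hGc ((measureReal_union_le _ _).trans (add_le_add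
        ((measureReal_iUnion_fintype_le _).trans (Finset.sum_le_sum fun i _ => hO i))
        ((measureReal_iUnion_fintype_le _).trans (Finset.sum_le_sum fun i _ => hU i))))).trans ?_))
    rw [Finset.sum_const, Finset.card_univ, Fintype.card_fin, nsmul_eq_mul]
    exact le_of_eq (by ring)
  exact (ENNReal.le_ofReal_iff_toReal_le (measure_ne_top (ν.prod (coinsLaw s N)) _)
    (by positivity)).2 hfin

end Correctness

/-! ### Comparison with the stated bound -/

section Cost

variable {f : ℝ → ℝ} {θ θ' θ'' ε₁ ε₂ : ℝ}

theorem ApproxInvertible.one_le_buckets (h : ApproxInvertible f θ θ' θ'' ε₁ ε₂) {s : ℕ}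
    (hs : 1 ≤ s) {K : ℝ} (hK : 0 < K) : 1 ≤ bucketsA K s θ ε₁ * bucketsB K s θ ε₁ ε₂ := by
  have hθ : 0 < Real.log θ := Real.log_pos h.one_lt_theta
  have hs1 : (1 : ℝ) ≤ s := by exact_mod_cast hs
  have h1 := h.eps₁_pos
  have h2 := h.eps₁_lt_one
  have h3 := h.eps₂_pos
  have h4 := h.eps₂_lt_one
  have hA : 0 < bucketsA K s θ ε₁ := by
    refine Nat.ceil_pos.2 (mul_pos hK (div_pos (Real.log_pos ?_) hθ))
    rw [lt_div_iff₀ h1]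
    linarith
  have hB : 0 < bucketsB K s θ ε₁ ε₂ := by
    refine Nat.ceil_pos.2 (mul_pos hK (div_pos (Real.log_pos ?_) hθ))
    rw [lt_div_iff₀ (mul_pos h1 (by linarith))]
    nlinarith
  exact Nat.mul_pos hA hB

/-- The factor `s` cancels the one in the denominator of `N`, so the draws cost `O(log³ n * c_f[s] /
ε₁)`, within the first term. Rounding, normalisations and the second round go into the second term.
-/
theorem ApproxInvertible.cost_le_wordBound (h : ApproxInvertible f θ θ' θ'' ε₁ ε₂) {n s m : ℕ}
    (hn : 2 ≤ n) (hs : 1 ≤ s) (hm : 1 ≤ m) {a b : ℝ} (ha : 0 ≤ a) (hb : 0 ≤ b) :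
    (s : ℝ) * (1 + 2 * ⌈a * Real.log n ^ 3 * cf f s / (ε₁ * s)⌉₊ +
      2 * (b * Real.log n ^ 2 * θ'' / (1 - ε₂))) ≤
      (4 * a + 2 * b + 12) * wordBound f n s m θ θ'' ε₁ ε₂ := by
  have hlog := one_le_two_mul_log hn
  set l := Real.log n
  have hl0 : 0 < l := by linarith
  have hs0 : (0 : ℝ) < s := by exact_mod_cast hs
  have hε₁ := h.eps₁_pos
  have hε₂ : 0 < 1 - ε₂ := by linarith [h.eps₂_lt_one]
  have hε₂' : 1 - ε₂ ≤ 1 := by linarith [h.eps₂_pos]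
  have hθ := h.one_lt_theta''
  have hcs := h.cf_nonneg hs
  have hcm := h.cf_nonneg hm
  have hceil : (⌈a * l ^ 3 * cf f s / (ε₁ * s)⌉₊ : ℝ) ≤ a * l ^ 3 * cf f s / (ε₁ * s) + 1 :=
    (Nat.ceil_lt_add_one (by positivity)).le
  have hfirst : 2 * (a * l ^ 3 * cf f s / ε₁) ≤
      4 * a * (cf f s * (cf f m * m * √θ * l ^ 4 / (ε₁ * (1 - ε₂) ^ 2))) := by
    -- If `f` is not identically zero, `c_f[m] ≥ m ≥ 1` makes the extra factors of the first term at
    -- least `1`; otherwise `c_f[s] = 0` and both sides vanish.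
    by_cases hf : ∃ z, 0 ≤ z ∧ 0 < f z
    · obtain ⟨z, hz, hfz⟩ := hf
      have hm1 : (1 : ℝ) ≤ m := by exact_mod_cast hm
      have hcm1 : 1 ≤ cf f m := hm1.trans (h.le_cf hz hfz hm)
      have hsq : 1 ≤ √θ := by rw [Real.one_le_sqrt]; exact h.one_lt_theta.le
      have hA : 1 ≤ cf f m * m * √θ :=
        one_le_mul_of_one_le_of_one_le (one_le_mul_of_one_le_of_one_le hcm1 hm1) hsq
      have hden : ε₁ * (1 - ε₂) ^ 2 ≤ ε₁ :=
        mul_le_of_le_one_right hε₁.le (pow_le_one₀ hε₂.le hε₂')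
      have hl : l ^ 3 ≤ 2 * l ^ 4 := by nlinarith [pow_pos hl0 3]
      calc 2 * (a * l ^ 3 * cf f s / ε₁) = 2 * a * (cf f s * (l ^ 3 / ε₁)) := by ring
        _ ≤ 2 * a * (cf f s * (cf f m * m * √θ * (2 * l ^ 4) / (ε₁ * (1 - ε₂) ^ 2))) := by
            gcongr
            nlinarith [pow_pos hl0 4]
        _ = _ := by ring
    · push Not at hf
      have hzero : cf f s = 0 :=
        h.cf_eq_zero (fun z hz => le_antisymm (hf z hz) (h.nonneg z hz)) hs
      simp [hzero]
  have hden3 : (1 - ε₂) ^ 3 ≤ 1 := pow_le_one₀ hε₂.le hε₂'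
  have hthree : 1 ≤ 4 * (l ^ 2 * θ'' / (1 - ε₂) ^ 3) := by
    rw [mul_div_assoc', le_div_iff₀ (by positivity)]
    nlinarith [pow_pos hl0 2]
  have hquad : l ^ 2 * θ'' / (1 - ε₂) ≤ l ^ 2 * θ'' / (1 - ε₂) ^ 3 := by
    gcongr
    nlinarith [pow_le_one₀ (n := 2) hε₂.le hε₂']
  set U := cf f s * (cf f m * m * √θ * l ^ 4 / (ε₁ * (1 - ε₂) ^ 2)) with hU
  set V := l ^ 2 * θ'' / (1 - ε₂) ^ 3 with hV
  have hU0 : 0 ≤ U := by positivity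
  have hV0 : 0 ≤ V := by positivity
  calc (s : ℝ) * (1 + 2 * ⌈a * l ^ 3 * cf f s / (ε₁ * s)⌉₊ + 2 * (b * l ^ 2 * θ'' / (1 - ε₂)))
      ≤ s * (1 + 2 * (a * l ^ 3 * cf f s / (ε₁ * s) + 1) + 2 * (b * l ^ 2 * θ'' / (1 - ε₂))) := by
        gcongr
    _ = 2 * (a * l ^ 3 * cf f s / ε₁) + s * 3 + s * (2 * (b * (l ^ 2 * θ'' / (1 - ε₂)))) := by
        field_simp
        ring
    _ ≤ 4 * a * U + s * (3 * (4 * V)) + s * (2 * (b * V)) := by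
        gcongr
        linarith
    _ ≤ (4 * a + 2 * b + 12) * (U + s * V) := by
        have : 0 ≤ a * (s * V) := by positivity
        have : 0 ≤ b * U := by positivity
        nlinarith
    _ = _ := rfl

end Cost

end

/-! ### Choice of constants and conclusion -/

theorem mainTheorem4 (c : ℕ) :
    ∃ K : ℝ, 0 < K ∧
      ∀ (n s : ℕ), 1 ≤ n → 1 ≤ s →
      ∀ (f : ℝ → ℝ) (θ θ' θ'' ε₁ ε₂ : ℝ), ApproxInvertible f θ θ' θ'' ε₁ ε₂ →
      ∃ P : TwoRoundProtocol s n,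
        ∀ x : Fin s → Fin n → ℝ, (∀ j i, 0 ≤ x j i) →
          (∀ (e : Fin n → ℝ) (ω : Fin s → P.Coin),
            P.NumbersAreHeld f x e ω ∧
            (P.communication x e ω : ℝ) ≤
              K * wordBound f n s (bucketsA K s θ ε₁ * bucketsB K s θ ε₁ ε₂) θ θ'' ε₁ ε₂) ∧
          P.law {r | P.result x r.1 r.2 ≠ ⨆ i : Fin n, (r.1 i)⁻¹ * f (∑ j, x j i)} ≤
            ENNReal.ofReal (1 / (n : ℝ) ^ c) := by
  -- The failure probability is `(2 + 4 * n) / n ^ T`, and `2 + 4 * n ≤ n ^ 4` for `n ≥ 2`.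
  set T : ℝ := c + 4 with hT
  have hT0 : 0 < T := by positivity
  set b : ℝ := (T + 2) * (T + 16) with hb
  have hb0 : 0 < b := by positivity
  -- Chosen so that `a * log³ n = 2 * L * D`, the number of draws that the lower tail requires.
  set a : ℝ := 2 * (8 * T) * b with ha
  have ha0 : 0 < a := by positivity
  refine ⟨4 * a + 2 * b + 12, by positivity, fun n s hn hs f θ θ' θ'' ε₁ ε₂ h => ?_⟩
  have hm := h.one_le_buckets hs (by positivity : 0 < 4 * a + 2 * b + 12)
  -- For `n = 1` the bound is zero words because `log 1 = 0`, but the permitted failure probability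
  -- is `1`, so silence suffices.
  rcases hn.eq_or_lt with rfl | hn2
  · refine ⟨silentProtocol s 1, fun x hx => ⟨fun e ω => ⟨⟨?_, ?_, ?_⟩, ?_⟩, ?_⟩⟩
    · exact fun j r hr => absurd hr List.not_mem_nil
    · exact fun j r hr => absurd hr List.not_mem_nil
    · exact fun j r hr => absurd hr List.not_mem_nil
    · have : (silentProtocol s 1).communication x e ω = 0 := Finset.sum_eq_zero fun j _ => rfl
      rw [this]
      simp [wordBound]
    · have : IsProbabilityMeasure (silentProtocol s 1).law := by
        unfold TwoRoundProtocol.law; infer_instance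
      simpa using prob_le_one
  · have hn2 : 2 ≤ n := hn2
    have hlog0 : 0 < Real.log n := by linarith [one_le_two_mul_log hn2]
    have hs0 : (0 : ℝ) < s := by exact_mod_cast hs
    have hε₁ := h.eps₁_pos
    have hε₂ : 0 < 1 - ε₂ := by linarith [h.eps₂_lt_one]
    have hθ : 0 < θ'' := by linarith [h.one_lt_theta'']
    set N := ⌈a * Real.log n ^ 3 * cf f s / (ε₁ * s)⌉₊ with hN
    set L := 8 * T * Real.log n with hL
    set D := b * Real.log n ^ 2 with hD
    refine ⟨samplingProtocol f s n N L (D * θ'' / (1 - ε₂)), fun x hx => ⟨fun e ω =>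
      ⟨samplingProtocol_numbersAreHeld _ _ x e ω, ?_⟩, ?_⟩⟩
    · exact (samplingProtocol_communication_le (by positivity) x e ω).trans
        (h.cost_le_wordBound hn2 hs hm ha0.le hb0.le)
    · have hNL : 2 * L * (cf f s * D) ≤ N * (ε₁ * s) := by
        have h1 := Nat.le_ceil (a * Real.log n ^ 3 * cf f s / (ε₁ * s))
        rw [div_le_iff₀ (by positivity)] at h1
        refine le_trans (le_of_eq ?_) h1
        rw [hL, hD, ha]
        ring
      refine (samplingProtocol_law_le h hs hn2 hx hT0 rfl rfl hNL).trans
        (ENNReal.ofReal_le_ofReal ?_)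
      have hn0 : (0 : ℝ) < n := by positivity
      have hn2' : (2 : ℝ) ≤ n := by exact_mod_cast hn2
      have hexp : Real.exp (-(T * Real.log n)) = 1 / (n : ℝ) ^ (c + 4) := by
        have : T * Real.log n = ((c + 4 : ℕ) : ℝ) * Real.log n := by rw [hT]; push_cast; rfl
        rw [this, Real.exp_neg, Real.exp_nat_mul, Real.exp_log hn0, one_div]
      rw [hexp, pow_add, mul_one_div, div_le_div_iff₀ (by positivity) (by positivity)]
      have h4 : 2 + 4 * (n : ℝ) ≤ n ^ 4 := by
        nlinarith [pow_le_pow_left₀ zero_le_two hn2' 3]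
      nlinarith [pow_pos hn0 c]
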